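/- Let $n\ge 4$, let $c\in\{-1,0,1\}$, and let $R^{n-1}(c)$ denote $\mathbb S^{n-1}$, $\mathbb E^{n-1}$ or $\mathbb H^{n-1}$ (with metric $g_c$) for $c=1$, $c=0$, $c=-1$, respectively. Let $I\subset\mathbb R$ be an open interval, let $f:I\to\mathbb R$ be smooth and nowhere zero, and let $L^n_1(f,c)=I\times_f R^{n-1}(c)$ be the Robertson-Walker space with metric $\widetilde g=-dt^2+f(t)^2g_c$. Assume that $$\frac{f''(t)}{f(t)}-\frac{f'(t)^2+c}{f(t)^2}\neq 0\qquad\text{for all } t\in I .$$ Let $\phi:M\to L^n_1(f,c)$ be a smooth immersion of a connected surface which is space-like (the induced metric is positive definite), and assume that the tangential part $T$ of $\frac{\partial}{\partial t}$ vanishes nowhere on $M$. Let $h$ be the second fundamental form, $\nabla^\perp$ the normal connection, and $H=\frac12\,\mathrm{tr}\,h$ the mean curvature vector field of $M$, and assume that $H$ vanishes nowhere. Suppose that $M$ has parallel mean curvature vector (PMCV), i.e. $\nabla^\perp H=0$, and that $M$ is biconservative, i.e. the tangential part of the bitension field $$\tau_2(\phi)=\Delta\tau(\phi)-\mathrm{tr}\,\widetilde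 R(d\phi,\tau(\phi))\,d\phi,\qquad \tau(\phi)=\mathrm{tr}\,\nabla d\phi,$$ vanishes, where $\Delta=\mathrm{tr}(\nabla_\cdot\nabla_\cdot)$ is the rough Laplacian on vector fields along $\phi$ and $\widetilde R(X,Y)=[\widetilde\nabla_X,\widetilde\nabla_Y]-\widetilde\nabla_{[X,Y]}$. Then $M$ has flat normal bundle: the curvature of the normal connection satisfies $R^\perp(X,Y)\xi=0$ for all tangent vector fields $X,Y$ and all normal vector fields $\xi$. -/

import Mathlib

open scoped Manifold ContDiff

noncomputable section

/-! Semi-Riemannian geometry in coordinates: `g` is the matrix of a metric in a coordinate system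
`x = (x_a)` on an open subset of `ℝⁿ`, and `F` is a map into that coordinate domain,
defined on an open subset of `ℝᵐ` with coordinates `u = (u_i)`. -/
namespace Coord

/-- The partial derivative `∂_i F` at `u`. -/
def pd {m : ℕ} {E : Type*} [NormedAddCommGroup E] [NormedSpace ℝ E]
    (i : Fin m) (F : (Fin m → ℝ) → E) (u : Fin m → ℝ) : E :=
  fderiv ℝ F u (Pi.single i 1)

/-- The scalar product `⟨v, w⟩ = g_ab v^a w^b` at the point `x`. -/
def inner {n : ℕ} (g : (Fin n → ℝ) → Matrix (Fin n) (Fin n) ℝ) (x v w : Fin n → ℝ) : ℝ :=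
  ∑ a, ∑ b, g x a b * v a * w b

/-- The Christoffel symbol `Γ^k_ij` of the Levi-Civita connection of `g`. -/
def christoffel {n : ℕ} (g : (Fin n → ℝ) → Matrix (Fin n) (Fin n) ℝ) (x : Fin n → ℝ)
    (k i j : Fin n) : ℝ :=
  (1 / 2) * ∑ l, (g x)⁻¹ k l *
    (pd i (fun y => g y j l) x + pd j (fun y => g y i l) x - pd l (fun y => g y i j) x)

/-- The curvature tensor `R(v, w)z`, for the sign convention
`R(X, Y)Z = ∇_X ∇_Y Z - ∇_Y ∇_X Z - ∇_[X,Y] Z`. -/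
def curvature {n : ℕ} (g : (Fin n → ℝ) → Matrix (Fin n) (Fin n) ℝ) (x v w z : Fin n → ℝ) :
    Fin n → ℝ := fun l =>
  ∑ i, ∑ j, ∑ k,
    (pd i (fun y => christoffel g y l j k) x - pd j (fun y => christoffel g y l i k) x
      + ∑ p, (christoffel g x l i p * christoffel g x p j k
        - christoffel g x l j p * christoffel g x p i k)) * v i * w j * z k

/-- The covariant derivative `∇_{∂_i} V` of a vector field `V` along `F`, for the Levi-Civita
connection of `g`. -/
def covDeriv {m n : ℕ} (g : (Fin n → ℝ) → Matrix (Fin n) (Fin n) ℝ)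
    (F : (Fin m → ℝ) → (Fin n → ℝ)) (i : Fin m) (V : (Fin m → ℝ) → (Fin n → ℝ))
    (u : Fin m → ℝ) : Fin n → ℝ := fun k =>
  pd i V u k + ∑ a, ∑ b, christoffel g (F u) k a b * pd i F u a * V u b

/-- The metric `⟨∂_i F, ∂_j F⟩` induced by `F`. -/
def induced {m n : ℕ} (g : (Fin n → ℝ) → Matrix (Fin n) (Fin n) ℝ)
    (F : (Fin m → ℝ) → (Fin n → ℝ)) (u : Fin m → ℝ) : Matrix (Fin m) (Fin m) ℝ :=
  Matrix.of fun i j => inner g (F u) (pd i F u) (pd j F u)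

/-- The tangential part of a vector `X` at the point `F u`. -/
def tangential {m n : ℕ} (g : (Fin n → ℝ) → Matrix (Fin n) (Fin n) ℝ)
    (F : (Fin m → ℝ) → (Fin n → ℝ)) (u : Fin m → ℝ) (X : Fin n → ℝ) : Fin n → ℝ :=
  ∑ i, ∑ j, ((induced g F u)⁻¹ i j * inner g (F u) X (pd j F u)) • pd i F u

/-- The normal part of a vector `X` at the point `F u`. -/
def normal {m n : ℕ} (g : (Fin n → ℝ) → Matrix (Fin n) (Fin n) ℝ)
    (F : (Fin m → ℝ) → (Fin n → ℝ)) (u : Fin m → ℝ) (X : Fin n → ℝ) : Fin n → ℝ :=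
  X - tangential g F u X

/-- The second fundamental form `h(∂_i, ∂_j)`. -/
def secondForm {m n : ℕ} (g : (Fin n → ℝ) → Matrix (Fin n) (Fin n) ℝ)
    (F : (Fin m → ℝ) → (Fin n → ℝ)) (i j : Fin m) (u : Fin m → ℝ) : Fin n → ℝ :=
  normal g F u (covDeriv g F i (pd j F) u)

/-- The mean curvature vector field `H = (1/m) tr h`. -/
def meanCurvature {m n : ℕ} (g : (Fin n → ℝ) → Matrix (Fin n) (Fin n) ℝ)
    (F : (Fin m → ℝ) → (Fin n → ℝ)) (u : Fin m → ℝ) : Fin n → ℝ :=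
  (1 / (m : ℝ)) • ∑ i, ∑ j, (induced g F u)⁻¹ i j • secondForm g F i j u

/-- The normal connection `∇^⊥_{∂_i} ξ`. -/
def normalConn {m n : ℕ} (g : (Fin n → ℝ) → Matrix (Fin n) (Fin n) ℝ)
    (F : (Fin m → ℝ) → (Fin n → ℝ)) (i : Fin m) (ξ : (Fin m → ℝ) → (Fin n → ℝ))
    (u : Fin m → ℝ) : Fin n → ℝ :=
  normal g F u (covDeriv g F i ξ u)

/-- The normal curvature `R^⊥(∂_i, ∂_j)ξ` (coordinate fields commute). -/
def normalCurvature {m n : ℕ} (g : (Fin n → ℝ) → Matrix (Fin n) (Fin n) ℝ)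
    (F : (Fin m → ℝ) → (Fin n → ℝ)) (i j : Fin m) (ξ : (Fin m → ℝ) → (Fin n → ℝ))
    (u : Fin m → ℝ) : Fin n → ℝ :=
  normalConn g F i (normalConn g F j ξ) u - normalConn g F j (normalConn g F i ξ) u

/-- The tension field `τ = tr ∇dF`, where the domain carries the induced metric. -/
def tension {m n : ℕ} (g : (Fin n → ℝ) → Matrix (Fin n) (Fin n) ℝ)
    (F : (Fin m → ℝ) → (Fin n → ℝ)) (u : Fin m → ℝ) : Fin n → ℝ :=
  ∑ i, ∑ j, (induced g F u)⁻¹ i j •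
    (covDeriv g F i (pd j F) u - ∑ k, christoffel (induced g F) u k i j • pd k F u)

/-- The rough Laplacian `ΔV = tr (∇_· ∇_· V)` of a vector field `V` along `F`. -/
def roughLaplacian {m n : ℕ} (g : (Fin n → ℝ) → Matrix (Fin n) (Fin n) ℝ)
    (F : (Fin m → ℝ) → (Fin n → ℝ)) (V : (Fin m → ℝ) → (Fin n → ℝ))
    (u : Fin m → ℝ) : Fin n → ℝ :=
  ∑ i, ∑ j, (induced g F u)⁻¹ i j •
    (covDeriv g F i (covDeriv g F j V) u
      - ∑ k, christoffel (induced g F) u k i j • covDeriv g F k V u)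

/-- The bitension field `τ₂ = Δτ - tr R(dF, τ)dF`. -/
def bitension {m n : ℕ} (g : (Fin n → ℝ) → Matrix (Fin n) (Fin n) ℝ)
    (F : (Fin m → ℝ) → (Fin n → ℝ)) (u : Fin m → ℝ) : Fin n → ℝ :=
  roughLaplacian g F (tension g F) u
    - ∑ i, ∑ j, (induced g F u)⁻¹ i j •
        curvature g (F u) (pd i F u) (tension g F u) (pd j F u)

/-- `ξ` is a smooth normal vector field on `V`. -/
def IsNormalField {m n : ℕ} (g : (Fin n → ℝ) → Matrix (Fin n) (Fin n) ℝ)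
    (F : (Fin m → ℝ) → (Fin n → ℝ)) (V : Set (Fin m → ℝ))
    (ξ : (Fin m → ℝ) → (Fin n → ℝ)) : Prop :=
  ContDiffOn ℝ ∞ ξ V ∧ ∀ u ∈ V, ∀ i, inner g (F u) (ξ u) (pd i F u) = 0

end Coord

/-! The Robertson-Walker space `L^{d+1}_1(f, c) = I ×_f R^d(c)`. -/
namespace RW

/-- The underlying set `I × R^d(c)`, with points `(t, s, y)`. The space form `R^d(c)` is
the hyperquadric `s² + c|y|² = 1` in `ℝ × ℝ^d` (with `s > 0` if `c ≤ 0`): the unit sphere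
for `c = 1`, the hyperplane `s = 1` for `c = 0`, and the upper sheet of the hyperboloid
`-s² + |y|² = -1` for `c = -1`. -/
def space (I : Set ℝ) (c : ℝ) (d : ℕ) : Set (ℝ × ℝ × (Fin d → ℝ)) :=
  {w | w.1 ∈ I ∧ w.2.1 ^ 2 + c * ∑ i, w.2.2 i ^ 2 = 1 ∧ (c ≤ 0 → 0 < w.2.1)}

/-- The bilinear form `-dt² + f(t)² (c ds² + |dy|²)` at `w = (t, s, y)`. It restricts to
the metric `-dt² + f(t)² g_c`, as the metric `g_c` of `R^d(c)` is induced by `c ds² + |dy|²`. -/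
def form (f : ℝ → ℝ) (c : ℝ) {d : ℕ} (w X Y : ℝ × ℝ × (Fin d → ℝ)) : ℝ :=
  -(X.1 * Y.1) + f w.1 ^ 2 * (c * X.2.1 * Y.2.1 + ∑ i, X.2.2 i * Y.2.2 i)

/-- Coordinates `(t, 2y / (1 + ε s))` on the part `1 + ε s > 0` of the space, i.e. `t` and
stereographic coordinates of `R^d(c)`. For `ε = 1` and `ε = -1` the two parts cover the
space (for `c ≤ 0` the part for `ε = 1` is everything and the other one is empty). -/
def coord (ε : ℝ) {d : ℕ} (w : ℝ × ℝ × (Fin d → ℝ)) : Fin (d + 1) → ℝ :=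
  Fin.cons w.1 fun i => 2 * w.2.2 i / (1 + ε * w.2.1)

/-- The parametrization of the space inverse to `coord ε`. -/
def param (c ε : ℝ) {d : ℕ} (x : Fin (d + 1) → ℝ) : ℝ × ℝ × (Fin d → ℝ) :=
  let q : ℝ := c * (∑ i : Fin d, x i.succ ^ 2) / 4
  (x 0, ε * ((1 - q) / (1 + q)), fun i => x i.succ / (1 + q))

/-- The matrix of the metric of the Robertson-Walker space in the coordinates `coord ε`. -/
def metric (f : ℝ → ℝ) (c ε : ℝ) {d : ℕ} (x : Fin (d + 1) → ℝ) :
    Matrix (Fin (d + 1)) (Fin (d + 1)) ℝ :=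
  Matrix.of fun a b =>
    form f c (param c ε x) (Coord.pd a (param c ε) x) (Coord.pd b (param c ε) x)

/-- The map `φ` from a surface into the space, in a chart `e` of the surface and the
coordinates `coord ε` of the space. -/
def localRep {M : Type*} [TopologicalSpace M] {d : ℕ} (φ : M → ℝ × ℝ × (Fin d → ℝ))
    (e : OpenPartialHomeomorph M (Fin 2 → ℝ)) (ε : ℝ) : (Fin 2 → ℝ) → (Fin (d + 1) → ℝ) :=
  fun u => coord ε (φ (e.symm u))

/-- The domain of `localRep φ e ε`. -/
def localDom {M : Type*} [TopologicalSpace M] {d : ℕ} (φ : M → ℝ × ℝ × (Fin d → ℝ))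
    (e : OpenPartialHomeomorph M (Fin 2 → ℝ)) (ε : ℝ) : Set (Fin 2 → ℝ) :=
  {u | u ∈ e.target ∧ 0 < 1 + ε * (φ (e.symm u)).2.1}

/-- A local property `P ε F u` of the coordinate expressions `F` of `φ`, with respect to the
coordinates `coord ε` of the space, holds in all charts, at every point of the surface. -/
def Everywhere {M : Type*} [TopologicalSpace M] [ChartedSpace (Fin 2 → ℝ) M] {d : ℕ}
    (φ : M → ℝ × ℝ × (Fin d → ℝ))
    (P : ℝ → ((Fin 2 → ℝ) → (Fin (d + 1) → ℝ)) → (Fin 2 → ℝ) → Prop) : Prop :=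
  ∀ e ∈ atlas (Fin 2 → ℝ) M, ∀ ε : ℝ, (ε = 1 ∨ ε = -1) →
    ∀ u ∈ localDom φ e ε, P ε (localRep φ e ε) u

/-- The surface is space-like: the induced metric is positive definite
(in particular, `φ` is an immersion). -/
def IsSpacelike (f : ℝ → ℝ) (c : ℝ) {M : Type*} [TopologicalSpace M]
    [ChartedSpace (Fin 2 → ℝ) M] {d : ℕ} (φ : M → ℝ × ℝ × (Fin d → ℝ)) : Prop :=
  Everywhere φ fun ε F u => (Coord.induced (metric f c ε) F u).PosDef

/-- The tangential part `T` of `∂/∂t` vanishes nowhere. -/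
def TangentialPartNeZero (f : ℝ → ℝ) (c : ℝ) {M : Type*} [TopologicalSpace M]
    [ChartedSpace (Fin 2 → ℝ) M] {d : ℕ} (φ : M → ℝ × ℝ × (Fin d → ℝ)) : Prop :=
  Everywhere φ fun ε F u => Coord.tangential (metric f c ε) F u (Pi.single 0 1) ≠ 0

/-- The mean curvature vector field vanishes nowhere. -/
def MeanCurvatureNeZero (f : ℝ → ℝ) (c : ℝ) {M : Type*} [TopologicalSpace M]
    [ChartedSpace (Fin 2 → ℝ) M] {d : ℕ} (φ : M → ℝ × ℝ × (Fin d → ℝ)) : Prop :=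
  Everywhere φ fun ε F u => Coord.meanCurvature (metric f c ε) F u ≠ 0

/-- The mean curvature vector field is parallel: `∇^⊥ H = 0`. -/
def IsPMCV (f : ℝ → ℝ) (c : ℝ) {M : Type*} [TopologicalSpace M]
    [ChartedSpace (Fin 2 → ℝ) M] {d : ℕ} (φ : M → ℝ × ℝ × (Fin d → ℝ)) : Prop :=
  Everywhere φ fun ε F u => ∀ i,
    Coord.normalConn (metric f c ε) F i (Coord.meanCurvature (metric f c ε) F) u = 0

/-- The surface is biconservative: the bitension field has no tangential part. -/
def IsBiconservative (f : ℝ → ℝ) (c : ℝ) {M : Type*} [TopologicalSpace M]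
    [ChartedSpace (Fin 2 → ℝ) M] {d : ℕ} (φ : M → ℝ × ℝ × (Fin d → ℝ)) : Prop :=
  Everywhere φ fun ε F u =>
    Coord.tangential (metric f c ε) F u (Coord.bitension (metric f c ε) F u) = 0

/-- The normal bundle is flat: `R^⊥(X, Y)ξ = 0` for all (local) normal vector fields `ξ`. -/
def HasFlatNormalBundle (f : ℝ → ℝ) (c : ℝ) {M : Type*} [TopologicalSpace M]
    [ChartedSpace (Fin 2 → ℝ) M] {d : ℕ} (φ : M → ℝ × ℝ × (Fin d → ℝ)) : Prop :=
  Everywhere φ fun ε F u => ∀ (V : Set (Fin 2 → ℝ)) (ξ : (Fin 2 → ℝ) → (Fin (d + 1) → ℝ)),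
    IsOpen V → u ∈ V → Coord.IsNormalField (metric f c ε) F V ξ →
      ∀ i j, Coord.normalCurvature (metric f c ε) F i j ξ u = 0

end RW

end

/-!
Everything is local, so let `F` be the expression of the surface in a chart and in the coordinates
`(t, x)` of the ambient space, whose metric is `-dt² + λ|dx|²` with
`λ = f(t)²/(1 + c|x|²/4)²` (`RW.metric_eq_diagonal`), and let `τ = 2H`.

If `∇^⊥ τ = 0`, the Codazzi equation and the constancy of `⟨τ, τ⟩` express the tangential part
of `Δτ`, hence that of the bitension field, through the ambient curvature alone
(`Coord.IsSubmanifoldOn.inner_roughLaplacian_tension`). The curvature of a Robertson-Walker space is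
`R(v, w)z = K(⟨w, z⟩v - ⟨v, z⟩w) + K'(z⁰(v⁰w - w⁰v) + (v⁰⟨w, z⟩ - w⁰⟨v, z⟩)∂_t)`,
where `K' = f''/f - (f'² + c)/f²` (`RW.curvature_metric`). Taking traces, the tangential part of
the bitension field is a nonzero multiple of `K' τ⁰ T`, so that `⟨τ, ∂_t⟩ = 0`
(`RW.tension_zero_eq_zero`).

As `∇_X ∂_t` is a combination of `X` and `∂_t`, differentiating `⟨τ, ∂_t⟩ = 0` gives `A_τ T = 0`.
Moreover `tr A_τ = ⟨τ, τ⟩`, which is positive since `τ` is nonzero and orthogonal to the time-like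
field `∂_t`. So `A_τ` is singular with nonzero trace; in particular it is not scalar
(`RW.weingarten_tension_ne_scalar`).

For normal `ξ` the vector `R(X, Y)ξ` is tangential, so the Ricci equation reads
`⟨R^⊥(X, Y)ξ, ζ⟩ = ⟨[A_ξ, A_ζ]X, Y⟩`. Since `R^⊥(X, Y)τ = 0`, all shape operators commute with
`A_τ`. The commutant of a non-scalar `2 × 2` matrix is commutative, so they commute with each other
and `R^⊥ = 0` (`Coord.IsSubmanifoldOn.normalCurvature_eq_zero`).
-/

noncomputable section

namespace Coord

/-! ### Partial derivatives -/

section PartialDerivative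
variable {m : ℕ} {E : Type*} [NormedAddCommGroup E] [NormedSpace ℝ E]
  {U : Set (Fin m → ℝ)} {u : Fin m → ℝ}

theorem contDiffOn_pd {F : (Fin m → ℝ) → E} (hU : IsOpen U) (hF : ContDiffOn ℝ ∞ F U)
    (i : Fin m) : ContDiffOn ℝ ∞ (pd i F) U :=
  (hF.fderiv_of_isOpen hU (by simp)).clm_apply contDiffOn_const

theorem differentiableAt_of_contDiffOn {F : (Fin m → ℝ) → E} (hU : IsOpen U)
    (hF : ContDiffOn ℝ ∞ F U) (hu : u ∈ U) : DifferentiableAt ℝ F u :=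
  (hF.contDiffAt (hU.mem_nhds hu)).differentiableAt (by simp)

theorem pd_congr {F G : (Fin m → ℝ) → E} (hU : IsOpen U) (hu : u ∈ U)
    (h : ∀ v ∈ U, F v = G v) (i : Fin m) : pd i F u = pd i G u := by
  unfold pd
  rw [Filter.EventuallyEq.fderiv_eq (Filter.eventually_of_mem (hU.mem_nhds hu) h)]

theorem pd_comm {F : (Fin m → ℝ) → E} (hU : IsOpen U) (hF : ContDiffOn ℝ ∞ F U) (hu : u ∈ U)
    (i j : Fin m) : pd i (pd j F) u = pd j (pd i F) u := by
  have hd : DifferentiableAt ℝ (fderiv ℝ F) u :=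
    ((hF.fderiv_of_isOpen (m := ∞) hU (by simp)).contDiffAt (hU.mem_nhds hu)).differentiableAt
      (by simp)
  have key : ∀ a b : Fin m, pd a (pd b F) u
      = fderiv ℝ (fderiv ℝ F) u (Pi.single a 1) (Pi.single b 1) := by
    intro a b
    unfold pd
    rw [fderiv_clm_apply hd (differentiableAt_const _)]
    simp
  rw [key, key]
  exact (hF.contDiffAt (hU.mem_nhds hu)).isSymmSndFDerivAt
    (by rw [minSmoothness_of_isRCLikeNormedField]
        exact WithTop.coe_le_coe.2 (le_top : (2 : ℕ∞) ≤ ⊤)) _ _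

theorem pd_add {F G : (Fin m → ℝ) → E} (hF : DifferentiableAt ℝ F u)
    (hG : DifferentiableAt ℝ G u) (i : Fin m) :
    pd i (fun v => F v + G v) u = pd i F u + pd i G u := by
  unfold pd
  rw [fderiv_fun_add hF hG]; rfl

theorem pd_sub {F G : (Fin m → ℝ) → E} (hF : DifferentiableAt ℝ F u)
    (hG : DifferentiableAt ℝ G u) (i : Fin m) :
    pd i (fun v => F v - G v) u = pd i F u - pd i G u := by
  unfold pd
  rw [fderiv_fun_sub hF hG]; rfl

theorem pd_sum {ι : Type*} {s : Finset ι} {F : ι → (Fin m → ℝ) → E}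
    (hF : ∀ a ∈ s, DifferentiableAt ℝ (F a) u) (i : Fin m) :
    pd i (fun v => ∑ a ∈ s, F a v) u = ∑ a ∈ s, pd i (F a) u := by
  unfold pd
  rw [fderiv_fun_sum hF]; simp

theorem pd_mul {p q : (Fin m → ℝ) → ℝ} (hp : DifferentiableAt ℝ p u)
    (hq : DifferentiableAt ℝ q u) (i : Fin m) :
    pd i (fun v => p v * q v) u = pd i p u * q u + p u * pd i q u := by
  unfold pd
  rw [fderiv_fun_mul hp hq]
  simp; ring

theorem pd_smul {p : (Fin m → ℝ) → ℝ} {F : (Fin m → ℝ) → E} (hp : DifferentiableAt ℝ p u)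
    (hF : DifferentiableAt ℝ F u) (i : Fin m) :
    pd i (fun v => p v • F v) u = pd i p u • F u + p u • pd i F u := by
  unfold pd
  rw [fderiv_fun_smul hp hF]
  simp; abel

theorem pd_apply {n : ℕ} {F : (Fin m → ℝ) → (Fin n → ℝ)} (hF : DifferentiableAt ℝ F u)
    (i : Fin m) (a : Fin n) : pd i (fun v => F v a) u = pd i F u a := by
  unfold pd
  rw [fderiv_apply hF]; rfl

theorem pd_comp {n : ℕ} {F : (Fin m → ℝ) → (Fin n → ℝ)} {G : (Fin n → ℝ) → E}
    (hG : DifferentiableAt ℝ G (F u)) (hF : DifferentiableAt ℝ F u) (i : Fin m) :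
    pd i (fun v => G (F v)) u = fderiv ℝ G (F u) (pd i F u) := by
  unfold pd
  rw [show (fun v => G (F v)) = G ∘ F from rfl, fderiv_comp u hG hF]; rfl

theorem fderiv_eq_sum_pd {G : (Fin m → ℝ) → ℝ} (v : Fin m → ℝ) :
    fderiv ℝ G u v = ∑ i, v i * pd i G u := by
  conv_lhs => rw [← Finset.univ_sum_single v, map_sum]
  refine Finset.sum_congr rfl fun i _ => ?_
  rw [pd, ← smul_eq_mul, ← map_smul]
  congr 1
  ext j
  by_cases h : j = i
  · subst h; simp
  · simp [h]

end PartialDerivative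

/-! ### The scalar product -/

section Inner
variable {n : ℕ} (g : (Fin n → ℝ) → Matrix (Fin n) (Fin n) ℝ) (x : Fin n → ℝ)

theorem inner_eq_toBilin (v w : Fin n → ℝ) : inner g x v w = Matrix.toBilin' (g x) v w := by
  rw [Matrix.toBilin'_apply]
  exact Finset.sum_congr rfl fun a _ => Finset.sum_congr rfl fun b _ => by ring

theorem inner_add_left (v v' w : Fin n → ℝ) :
    inner g x (v + v') w = inner g x v w + inner g x v' w := by simp [inner_eq_toBilin]

theorem inner_add_right (v w w' : Fin n → ℝ) :
    inner g x v (w + w') = inner g x v w + inner g x v w' := by simp [inner_eq_toBilin]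

theorem inner_sub_left (v v' w : Fin n → ℝ) :
    inner g x (v - v') w = inner g x v w - inner g x v' w := by simp [inner_eq_toBilin]

theorem inner_smul_left (r : ℝ) (v w : Fin n → ℝ) :
    inner g x (r • v) w = r * inner g x v w := by simp [inner_eq_toBilin]

theorem inner_smul_right (r : ℝ) (v w : Fin n → ℝ) :
    inner g x v (r • w) = r * inner g x v w := by simp [inner_eq_toBilin]

theorem inner_sum_left {ι : Type*} (s : Finset ι) (v : ι → Fin n → ℝ) (w : Fin n → ℝ) :
    inner g x (∑ i ∈ s, v i) w = ∑ i ∈ s, inner g x (v i) w := by simp [inner_eq_toBilin]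

theorem inner_sum_right {ι : Type*} (s : Finset ι) (v : Fin n → ℝ) (w : ι → Fin n → ℝ) :
    inner g x v (∑ i ∈ s, w i) = ∑ i ∈ s, inner g x v (w i) := by simp [inner_eq_toBilin]

@[simp] theorem inner_zero_left (w : Fin n → ℝ) : inner g x 0 w = 0 := by simp [inner_eq_toBilin]

theorem inner_comm {g : (Fin n → ℝ) → Matrix (Fin n) (Fin n) ℝ} {x : Fin n → ℝ}
    (h : (g x).IsSymm) (v w : Fin n → ℝ) : inner g x v w = inner g x w v := by
  unfold inner
  rw [Finset.sum_comm]
  refine Finset.sum_congr rfl fun a _ => Finset.sum_congr rfl fun b _ => ?_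
  rw [h.apply]; ring

end Inner

/-! ### The Levi-Civita connection in coordinates -/

/-- `g` is the coordinate matrix of a smooth semi-Riemannian metric on the open set `D`. -/
structure IsMetricOn {n : ℕ} (g : (Fin n → ℝ) → Matrix (Fin n) (Fin n) ℝ)
    (D : Set (Fin n → ℝ)) : Prop where
  isOpen : IsOpen D
  contDiffOn : ∀ a b, ContDiffOn ℝ ∞ (fun x => g x a b) D
  symm : ∀ x ∈ D, (g x).IsSymm
  isUnit_det : ∀ x ∈ D, IsUnit (g x).det

theorem contDiffOn_det {n : ℕ} {E : Type*} [NormedAddCommGroup E] [NormedSpace ℝ E]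
    {A : E → Matrix (Fin n) (Fin n) ℝ} {D : Set E}
    (hA : ∀ a b, ContDiffOn ℝ ∞ (fun x => A x a b) D) :
    ContDiffOn ℝ ∞ (fun x => (A x).det) D := by
  simp only [Matrix.det_apply]
  refine ContDiffOn.sum fun σ _ => ?_
  simp only [Units.smul_def, zsmul_eq_mul]
  exact contDiffOn_const.mul (contDiffOn_prod fun i _ => hA _ _)

theorem contDiffOn_matrix_inv {n : ℕ} {E : Type*} [NormedAddCommGroup E] [NormedSpace ℝ E]
    {A : E → Matrix (Fin n) (Fin n) ℝ} {D : Set E}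
    (hA : ∀ a b, ContDiffOn ℝ ∞ (fun x => A x a b) D) (hdet : ∀ x ∈ D, IsUnit (A x).det)
    (a b : Fin n) : ContDiffOn ℝ ∞ (fun x => (A x)⁻¹ a b) D := by
  simp only [Matrix.inv_def, Matrix.smul_apply, Matrix.adjugate_apply, Ring.inverse_eq_inv',
    smul_eq_mul]
  refine ((contDiffOn_det hA).inv fun x hx => (hdet x hx).ne_zero).mul (contDiffOn_det ?_)
  intro i j
  by_cases h : i = b
  · subst h
    simpa using contDiffOn_const
  · simpa [Matrix.updateRow_ne h] using hA i j

section LeviCivita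
variable {n : ℕ} {g : (Fin n → ℝ) → Matrix (Fin n) (Fin n) ℝ} {D : Set (Fin n → ℝ)}
  {x : Fin n → ℝ}

theorem IsMetricOn.contDiffOn_inv (hg : IsMetricOn g D) (a b : Fin n) :
    ContDiffOn ℝ ∞ (fun x => (g x)⁻¹ a b) D :=
  contDiffOn_matrix_inv hg.contDiffOn hg.isUnit_det a b

theorem IsMetricOn.contDiffOn_christoffel (hg : IsMetricOn g D) (k i j : Fin n) :
    ContDiffOn ℝ ∞ (fun x => christoffel g x k i j) D := by
  unfold christoffel
  refine contDiffOn_const.mul (ContDiffOn.sum fun l _ => (hg.contDiffOn_inv k l).mul ?_)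
  exact ((contDiffOn_pd hg.isOpen (hg.contDiffOn _ _) _).add
    (contDiffOn_pd hg.isOpen (hg.contDiffOn _ _) _)).sub
    (contDiffOn_pd hg.isOpen (hg.contDiffOn _ _) _)

theorem IsMetricOn.pd_symm (hg : IsMetricOn g D) (hx : x ∈ D) (l i j : Fin n) :
    pd l (fun y => g y i j) x = pd l (fun y => g y j i) x :=
  pd_congr hg.isOpen hx (fun y hy => (hg.symm y hy).apply j i) l

theorem IsMetricOn.christoffel_symm (hg : IsMetricOn g D) (hx : x ∈ D) (k i j : Fin n) :
    christoffel g x k i j = christoffel g x k j i := by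
  unfold christoffel
  congr 1
  refine Finset.sum_congr rfl fun l _ => ?_
  rw [hg.pd_symm hx l i j]; ring

/-- The Christoffel symbols of the first kind. -/
theorem IsMetricOn.sum_mul_christoffel (hg : IsMetricOn g D) (hx : x ∈ D) (l i j : Fin n) :
    ∑ k, g x k l * christoffel g x k i j
      = (1 / 2) * (pd i (fun y => g y j l) x + pd j (fun y => g y i l) x
        - pd l (fun y => g y i j) x) := by
  unfold christoffel
  have h1 : ∀ p, ∑ k, g x k l * (g x)⁻¹ k p = if l = p then 1 else 0 := by
    intro p
    have := congrFun (congrFun (Matrix.mul_nonsing_inv (g x) (hg.isUnit_det x hx)) l) p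
    rw [Matrix.mul_apply, Matrix.one_apply] at this
    rw [← this]
    exact Finset.sum_congr rfl fun k _ => by rw [(hg.symm x hx).apply]
  set r : Fin n → ℝ := fun p => pd i (fun y => g y j p) x + pd j (fun y => g y i p) x
        - pd p (fun y => g y i j) x
  calc ∑ k, g x k l * ((1 / 2) * ∑ p, (g x)⁻¹ k p * r p)
      = (1 / 2) * ∑ p, (∑ k, g x k l * (g x)⁻¹ k p) * r p := by
        simp only [Finset.mul_sum, Finset.sum_mul]
        rw [Finset.sum_comm]
        exact Finset.sum_congr rfl fun _ _ => Finset.sum_congr rfl fun _ _ => by ring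
    _ = (1 / 2) * r l := by simp [h1]

/-- The coordinate form of `∇g = 0`. -/
theorem IsMetricOn.pd_metric (hg : IsMetricOn g D) (hx : x ∈ D) (i j l : Fin n) :
    pd i (fun y => g y j l) x
      = ∑ k, (christoffel g x k i j * g x k l + christoffel g x k i l * g x j k) := by
  have h1 := hg.sum_mul_christoffel hx l i j
  have h2 := hg.sum_mul_christoffel hx j i l
  rw [hg.pd_symm hx i l j, hg.pd_symm hx l i j] at h2
  rw [Finset.sum_add_distrib]
  have e1 : ∑ k, christoffel g x k i j * g x k l = ∑ k, g x k l * christoffel g x k i j :=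
    Finset.sum_congr rfl fun k _ => mul_comm _ _
  have e2 : ∑ k, christoffel g x k i l * g x j k = ∑ k, g x k j * christoffel g x k i l :=
    Finset.sum_congr rfl fun k _ => by rw [(hg.symm x hx).apply k j, mul_comm]
  rw [e1, e2, h1, h2, hg.pd_symm hx l j i]; ring

variable (g x) in
/-- The Christoffel symbols as a bilinear map: `(Γ(v, w))^k = Γ^k_ab v^a w^b`. -/
def chris (v w : Fin n → ℝ) : Fin n → ℝ := fun k =>
  ∑ a, ∑ b, christoffel g x k a b * v a * w b

variable (g x) in
/-- The derivative of the Christoffel symbols in the direction `z`, as a bilinear map. -/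
def dchris (z v w : Fin n → ℝ) : Fin n → ℝ := fun k =>
  ∑ a, ∑ b, fderiv ℝ (fun y => christoffel g y k a b) x z * v a * w b

theorem chris_add_right (v w w' : Fin n → ℝ) :
    chris g x v (w + w') = chris g x v w + chris g x v w' := by
  ext k
  simp [chris, mul_add, Finset.sum_add_distrib]

theorem IsMetricOn.chris_symm (hg : IsMetricOn g D) (hx : x ∈ D) (v w : Fin n → ℝ) :
    chris g x v w = chris g x w v := by
  ext k
  unfold chris
  rw [Finset.sum_comm]
  exact Finset.sum_congr rfl fun a _ => Finset.sum_congr rfl fun b _ => by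
    rw [hg.christoffel_symm hx]; ring

theorem curvature_eq (v w z : Fin n → ℝ) :
    curvature g x v w z = dchris g x v w z - dchris g x w v z
      + (chris g x v (chris g x w z) - chris g x w (chris g x v z)) := by
  ext l
  simp only [curvature, dchris, chris, Pi.add_apply, Pi.sub_apply, fderiv_eq_sum_pd]
  simp only [add_mul, sub_mul, Finset.sum_add_distrib, Finset.sum_sub_distrib, Finset.sum_mul,
    Finset.mul_sum]
  congr 1
  · congr 1
    · rw [Finset.sum_comm]
      refine Finset.sum_congr rfl fun a _ => ?_
      rw [Finset.sum_comm]
      exact Finset.sum_congr rfl fun b _ => Finset.sum_congr rfl fun c _ => by ring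
    · refine Finset.sum_congr rfl fun a _ => ?_
      rw [Finset.sum_comm]
      exact Finset.sum_congr rfl fun b _ => Finset.sum_congr rfl fun c _ => by ring
  · congr 1
    · refine Finset.sum_congr rfl fun a _ => ?_
      rw [Finset.sum_congr rfl fun b _ => Finset.sum_comm, Finset.sum_comm]
      exact Finset.sum_congr rfl fun b _ => Finset.sum_congr rfl fun c _ =>
        Finset.sum_congr rfl fun e _ => by ring
    · rw [Finset.sum_comm]
      refine Finset.sum_congr rfl fun a _ => ?_
      rw [Finset.sum_congr rfl fun b _ => Finset.sum_comm, Finset.sum_comm]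
      exact Finset.sum_congr rfl fun b _ => Finset.sum_congr rfl fun c _ =>
        Finset.sum_congr rfl fun e _ => by ring

/-- `Dg(z)(v, w) = ⟨Γ(z, v), w⟩ + ⟨v, Γ(z, w)⟩`. -/
theorem IsMetricOn.fderiv_metric (hg : IsMetricOn g D) (hx : x ∈ D) (z v w : Fin n → ℝ) :
    ∑ a, ∑ b, fderiv ℝ (fun y => g y a b) x z * v a * w b
      = inner g x (chris g x z v) w + inner g x v (chris g x z w) := by
  simp only [fderiv_eq_sum_pd, hg.pd_metric hx, inner, chris, Finset.sum_add_distrib,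
    Finset.sum_mul, Finset.mul_sum, mul_add, add_mul]
  congr 1
  · have : ∀ a, (∑ b, ∑ c, ∑ k, z c * (christoffel g x k c a * g x k b) * v a * w b)
        = ∑ k, ∑ b, ∑ c, z c * (christoffel g x k c a * g x k b) * v a * w b := by
      intro a
      rw [Finset.sum_comm' (t' := Finset.univ) (s' := fun _ => Finset.univ) (by simp),
        Finset.sum_congr rfl fun b _ => Finset.sum_comm, Finset.sum_comm]
      exact Finset.sum_congr rfl fun k _ => Finset.sum_comm
    rw [Finset.sum_congr rfl fun a _ => this a, Finset.sum_comm]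
    refine Finset.sum_congr rfl fun k _ => ?_
    rw [Finset.sum_comm]
    refine Finset.sum_congr rfl fun b _ => ?_
    rw [Finset.sum_comm]
    exact Finset.sum_congr rfl fun c _ => Finset.sum_congr rfl fun e _ => by ring
  · refine Finset.sum_congr rfl fun a _ => ?_
    rw [Finset.sum_congr rfl fun b _ => Finset.sum_comm, Finset.sum_comm]
    refine Finset.sum_congr rfl fun k _ => ?_
    rw [Finset.sum_comm]
    exact Finset.sum_congr rfl fun c _ => Finset.sum_congr rfl fun e _ => by ring

end LeviCivita

/-! ### Vector fields along a map -/

section AlongMap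
variable {m n : ℕ} {g : (Fin n → ℝ) → Matrix (Fin n) (Fin n) ℝ} {D : Set (Fin n → ℝ)}
  {F : (Fin m → ℝ) → (Fin n → ℝ)} {U : Set (Fin m → ℝ)} {u : Fin m → ℝ}
  {V W : (Fin m → ℝ) → (Fin n → ℝ)}

theorem covDeriv_eq (i : Fin m) :
    covDeriv g F i V u = pd i V u + chris g (F u) (pd i F u) (V u) := rfl

theorem IsMetricOn.contDiffOn_inner (hg : IsMetricOn g D) (hF : ContDiffOn ℝ ∞ F U)
    (hFD : Set.MapsTo F U D) (hV : ContDiffOn ℝ ∞ V U) (hW : ContDiffOn ℝ ∞ W U) :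
    ContDiffOn ℝ ∞ (fun u => inner g (F u) (V u) (W u)) U := by
  unfold inner
  refine ContDiffOn.sum fun a _ => ContDiffOn.sum fun b _ => ?_
  exact (((hg.contDiffOn a b).comp hF hFD).mul (contDiffOn_pi.1 hV a)).mul (contDiffOn_pi.1 hW b)

theorem IsMetricOn.contDiffOn_chris (hg : IsMetricOn g D) (hF : ContDiffOn ℝ ∞ F U)
    (hFD : Set.MapsTo F U D) (hV : ContDiffOn ℝ ∞ V U) (hW : ContDiffOn ℝ ∞ W U) :
    ContDiffOn ℝ ∞ (fun u => chris g (F u) (V u) (W u)) U := by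
  refine contDiffOn_pi.2 fun k => ?_
  unfold chris
  refine ContDiffOn.sum fun a _ => ContDiffOn.sum fun b _ => ?_
  exact (((hg.contDiffOn_christoffel k a b).comp hF hFD).mul (contDiffOn_pi.1 hV a)).mul
    (contDiffOn_pi.1 hW b)

theorem IsMetricOn.contDiffOn_covDeriv (hg : IsMetricOn g D) (hU : IsOpen U)
    (hF : ContDiffOn ℝ ∞ F U) (hFD : Set.MapsTo F U D) (hV : ContDiffOn ℝ ∞ V U) (i : Fin m) :
    ContDiffOn ℝ ∞ (covDeriv g F i V) U :=
  (contDiffOn_pd hU hV i).add (hg.contDiffOn_chris hF hFD (contDiffOn_pd hU hF i) hV)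

/-- The Leibniz rule for a bilinear expression in `V` and `W` with coefficients depending
on `F`. -/
theorem pd_sum_mul_mul {T : (Fin n → ℝ) → Matrix (Fin n) (Fin n) ℝ}
    (hT : ∀ a b, DifferentiableAt ℝ (fun x => T x a b) (F u)) (hF : DifferentiableAt ℝ F u)
    (hV : DifferentiableAt ℝ V u) (hW : DifferentiableAt ℝ W u) (i : Fin m) :
    pd i (fun u => ∑ a, ∑ b, T (F u) a b * V u a * W u b) u
      = ∑ a, ∑ b, fderiv ℝ (fun x => T x a b) (F u) (pd i F u) * V u a * W u b
        + (∑ a, ∑ b, T (F u) a b * pd i V u a * W u b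
        + ∑ a, ∑ b, T (F u) a b * V u a * pd i W u b) := by
  have dT : ∀ a b, DifferentiableAt ℝ (fun u => T (F u) a b) u := fun a b =>
    DifferentiableAt.comp u (hT a b) hF
  have dV : ∀ a, DifferentiableAt ℝ (fun u => V u a) u := differentiableAt_pi.1 hV
  have dW : ∀ a, DifferentiableAt ℝ (fun u => W u a) u := differentiableAt_pi.1 hW
  have d1 : ∀ a b, DifferentiableAt ℝ (fun u => T (F u) a b * V u a) u := fun a b =>
    (dT a b).mul (dV a)
  have d2 : ∀ a b, DifferentiableAt ℝ (fun u => T (F u) a b * V u a * W u b) u := fun a b =>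
    (d1 a b).mul (dW b)
  rw [pd_sum fun a _ => DifferentiableAt.fun_sum fun b _ => d2 a b]
  simp only [← Finset.sum_add_distrib]
  refine Finset.sum_congr rfl fun a _ => ?_
  rw [pd_sum fun b _ => d2 a b]
  refine Finset.sum_congr rfl fun b _ => ?_
  rw [pd_mul (d1 a b) (dW b), pd_mul (dT a b) (dV a), pd_comp (G := fun x => T x a b) (hT a b) hF,
    pd_apply hV, pd_apply hW]
  ring

/-- The Levi-Civita connection is metric. -/
theorem IsMetricOn.pd_inner (hg : IsMetricOn g D) (hF : DifferentiableAt ℝ F u)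
    (hu : F u ∈ D) (hV : DifferentiableAt ℝ V u) (hW : DifferentiableAt ℝ W u) (i : Fin m) :
    pd i (fun u => inner g (F u) (V u) (W u)) u
      = inner g (F u) (covDeriv g F i V u) (W u) + inner g (F u) (V u) (covDeriv g F i W u) := by
  have h := pd_sum_mul_mul (T := g)
    (fun a b => differentiableAt_of_contDiffOn hg.isOpen (hg.contDiffOn a b) hu) hF hV hW i
  rw [hg.fderiv_metric hu] at h
  rw [covDeriv_eq, covDeriv_eq, inner_add_left, inner_add_right]
  refine h.trans ?_
  unfold inner
  ring

/-- The Levi-Civita connection is torsion-free. -/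
theorem IsMetricOn.covDeriv_pd_comm (hg : IsMetricOn g D) (hU : IsOpen U)
    (hF : ContDiffOn ℝ ∞ F U) (hFD : Set.MapsTo F U D) (hu : u ∈ U) (i j : Fin m) :
    covDeriv g F i (pd j F) u = covDeriv g F j (pd i F) u := by
  rw [covDeriv_eq, covDeriv_eq, pd_comm hU hF hu, hg.chris_symm (hFD hu)]

/-- Covariant derivatives along a map commute up to the curvature. -/
theorem IsMetricOn.covDeriv_covDeriv_sub (hg : IsMetricOn g D) (hU : IsOpen U)
    (hF : ContDiffOn ℝ ∞ F U) (hFD : Set.MapsTo F U D) (hV : ContDiffOn ℝ ∞ V U) (hu : u ∈ U)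
    (i j : Fin m) :
    covDeriv g F i (covDeriv g F j V) u - covDeriv g F j (covDeriv g F i V) u
      = curvature g (F u) (pd i F u) (pd j F u) (V u) := by
  have key : ∀ i j, covDeriv g F i (covDeriv g F j V) u
      = pd i (pd j V) u + dchris g (F u) (pd i F u) (pd j F u) (V u)
        + chris g (F u) (pd i (pd j F) u) (V u) + chris g (F u) (pd j F u) (pd i V u)
        + chris g (F u) (pd i F u) (pd j V u)
        + chris g (F u) (pd i F u) (chris g (F u) (pd j F u) (V u)) := by
    intro i j
    have dF := differentiableAt_of_contDiffOn hU hF hu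
    have dV := differentiableAt_of_contDiffOn hU hV hu
    have dFj := differentiableAt_of_contDiffOn hU (contDiffOn_pd hU hF j) hu
    have dVj := differentiableAt_of_contDiffOn hU (contDiffOn_pd hU hV j) hu
    have dc := differentiableAt_of_contDiffOn hU
      (hg.contDiffOn_chris hF hFD (contDiffOn_pd hU hF j) hV) hu
    have h1 : pd i (covDeriv g F j V) u
        = pd i (pd j V) u + pd i (fun u => chris g (F u) (pd j F u) (V u)) u :=
      pd_add dVj dc i
    have h2 : pd i (fun u => chris g (F u) (pd j F u) (V u)) u
        = dchris g (F u) (pd i F u) (pd j F u) (V u)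
          + (chris g (F u) (pd i (pd j F) u) (V u) + chris g (F u) (pd j F u) (pd i V u)) := by
      ext k
      rw [← pd_apply dc]
      exact pd_sum_mul_mul (T := fun x => Matrix.of fun a b => christoffel g x k a b)
        (fun a b => differentiableAt_of_contDiffOn hg.isOpen
          (hg.contDiffOn_christoffel k a b) (hFD hu)) dF dFj dV i
    rw [covDeriv_eq, h1, h2, covDeriv_eq, chris_add_right]
    abel
  rw [key, key, pd_comm hU hV hu i j, pd_comm hU hF hu i j, curvature_eq]
  abel

end AlongMap
/-! ### The trace of a symmetric bilinear form -/

section Trace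
variable {m : ℕ} {g : (Fin m → ℝ) → Matrix (Fin m) (Fin m) ℝ} {U : Set (Fin m → ℝ)}
  {u : Fin m → ℝ}

/-- The coordinate form of `∇g⁻¹ = 0`. -/
theorem IsMetricOn.pd_inv (hg : IsMetricOn g U) (hu : u ∈ U) (l i j : Fin m) :
    pd l (fun v => (g v)⁻¹ i j) u
      = -∑ k, ((g u)⁻¹ i k * christoffel g u j l k + christoffel g u i l k * (g u)⁻¹ k j) := by
  have dg : ∀ a b, DifferentiableAt ℝ (fun v => g v a b) u := fun a b =>
    differentiableAt_of_contDiffOn hg.isOpen (hg.contDiffOn a b) hu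
  have di : ∀ a b, DifferentiableAt ℝ (fun v => (g v)⁻¹ a b) u := fun a b =>
    differentiableAt_of_contDiffOn hg.isOpen (hg.contDiffOn_inv a b) hu
  let G' : Matrix (Fin m) (Fin m) ℝ := Matrix.of fun a b => pd l (fun v => g v a b) u
  let B' : Matrix (Fin m) (Fin m) ℝ := Matrix.of fun a b => pd l (fun v => (g v)⁻¹ a b) u
  let Γ : Matrix (Fin m) (Fin m) ℝ := Matrix.of fun k a => christoffel g u k l a
  have hG' : G' = Γ.transpose * g u + g u * Γ := by
    ext a b
    simp only [G', Γ, Matrix.of_apply, hg.pd_metric hu, Finset.sum_add_distrib, Matrix.add_apply,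
      Matrix.mul_apply, Matrix.transpose_apply]
    exact congrArg _ (Finset.sum_congr rfl fun k _ => mul_comm _ _)
  -- differentiate `g⁻¹ g = 1`
  have h0 : B' * g u + (g u)⁻¹ * G' = 0 := by
    ext a b
    have h1 : pd l (fun v => ∑ k, (g v)⁻¹ a k * g v k b) u = 0 := by
      rw [pd_congr hg.isOpen hu (G := fun _ => (1 : Matrix (Fin m) (Fin m) ℝ) a b)
        (fun v hv => by
          rw [← Matrix.nonsing_inv_mul (g v) (hg.isUnit_det v hv), Matrix.mul_apply]) l]
      simp [pd]
    have dp : ∀ k, DifferentiableAt ℝ (fun v => (g v)⁻¹ a k * g v k b) u := fun k =>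
      (di a k).mul (dg k b)
    rw [pd_sum fun k _ => dp k] at h1
    rw [Matrix.add_apply, Matrix.mul_apply, Matrix.mul_apply, ← Finset.sum_add_distrib,
      Matrix.zero_apply, ← h1]
    exact Finset.sum_congr rfl fun k _ => (pd_mul (di a k) (dg k b) l).symm
  have h2 : B' = -((g u)⁻¹ * Γ.transpose + Γ * (g u)⁻¹) := by
    have hu' := hg.isUnit_det u hu
    have h3 : B' * g u = -((g u)⁻¹ * G') := eq_neg_of_add_eq_zero_left h0
    calc B' = B' * g u * (g u)⁻¹ := (Matrix.mul_nonsing_inv_cancel_right _ _ hu').symm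
      _ = -((g u)⁻¹ * Γ.transpose * (g u * (g u)⁻¹) + (g u)⁻¹ * g u * Γ * (g u)⁻¹) := by
        rw [h3, hG']; noncomm_ring
      _ = _ := by rw [Matrix.mul_nonsing_inv _ hu', Matrix.nonsing_inv_mul _ hu']; simp
  have h4 := congrFun (congrFun h2 i) j
  simpa [B', Γ, Matrix.mul_apply, Finset.sum_add_distrib] using h4

/-- Covariant differentiation commutes with the trace. -/
theorem IsMetricOn.pd_trace (hg : IsMetricOn g U) (hu : u ∈ U)
    {a : Fin m → Fin m → (Fin m → ℝ) → ℝ} (ha : ∀ i j, DifferentiableAt ℝ (a i j) u)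
    (l : Fin m) :
    pd l (fun v => ∑ i, ∑ j, (g v)⁻¹ i j * a i j v) u
      = ∑ i, ∑ j, (g u)⁻¹ i j * (pd l (a i j) u - ∑ k, christoffel g u k l i * a k j u
        - ∑ k, christoffel g u k l j * a i k u) := by
  have di : ∀ a b, DifferentiableAt ℝ (fun v => (g v)⁻¹ a b) u := fun a b =>
    differentiableAt_of_contDiffOn hg.isOpen (hg.contDiffOn_inv a b) hu
  have h1 : pd l (fun v => ∑ i, ∑ j, (g v)⁻¹ i j * a i j v) u
      = ∑ i, ∑ j, (pd l (fun v => (g v)⁻¹ i j) u * a i j u + (g u)⁻¹ i j * pd l (a i j) u) := by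
    have dp : ∀ i j, DifferentiableAt ℝ (fun v => (g v)⁻¹ i j * a i j v) u := fun i j =>
      (di i j).mul (ha i j)
    rw [pd_sum fun i _ => DifferentiableAt.fun_sum fun j _ => dp i j]
    refine Finset.sum_congr rfl fun i _ => ?_
    rw [pd_sum fun j _ => dp i j]
    exact Finset.sum_congr rfl fun j _ => pd_mul (di i j) (ha i j) l
  rw [h1]
  simp only [hg.pd_inv hu, Finset.sum_add_distrib, mul_sub, Finset.sum_sub_distrib, neg_mul,
    Finset.sum_neg_distrib, add_mul, neg_add, Finset.sum_mul, Finset.mul_sum]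
  have e1 : ∑ i, ∑ j, ∑ k, (g u)⁻¹ i k * christoffel g u j l k * a i j u
      = ∑ i, ∑ j, ∑ k, (g u)⁻¹ i j * (christoffel g u k l j * a i k u) := by
    refine Finset.sum_congr rfl fun i _ => ?_
    rw [Finset.sum_comm]
    exact Finset.sum_congr rfl fun j _ => Finset.sum_congr rfl fun k _ => by ring
  have e2 : ∑ i, ∑ j, ∑ k, christoffel g u i l k * (g u)⁻¹ k j * a i j u
      = ∑ i, ∑ j, ∑ k, (g u)⁻¹ i j * (christoffel g u k l i * a k j u) := by
    rw [Finset.sum_congr rfl fun i _ => Finset.sum_comm, Finset.sum_comm]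
    refine Finset.sum_congr rfl fun i _ => ?_
    rw [Finset.sum_comm]
    exact Finset.sum_congr rfl fun j _ => Finset.sum_congr rfl fun k _ => by ring
  rw [e1, e2]; ring

end Trace

/-! ### Submanifolds -/

/-- `F` maps the open set `U` smoothly into the domain `D` of the metric `g`, and the metric
induced on `U` is nondegenerate. -/
structure IsSubmanifoldOn {m n : ℕ} (g : (Fin n → ℝ) → Matrix (Fin n) (Fin n) ℝ)
    (D : Set (Fin n → ℝ)) (F : (Fin m → ℝ) → (Fin n → ℝ)) (U : Set (Fin m → ℝ)) : Prop where
  isMetricOn : IsMetricOn g D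
  isOpen : IsOpen U
  contDiffOn : ContDiffOn ℝ ∞ F U
  mapsTo : Set.MapsTo F U D
  isUnit_det : ∀ u ∈ U, IsUnit (induced g F u).det

section Submanifold
variable {m n : ℕ} {g : (Fin n → ℝ) → Matrix (Fin n) (Fin n) ℝ} {D : Set (Fin n → ℝ)}
  {F : (Fin m → ℝ) → (Fin n → ℝ)} {U : Set (Fin m → ℝ)} {u : Fin m → ℝ}
  {X Y : (Fin m → ℝ) → (Fin n → ℝ)}

theorem covDeriv_sub (hX : DifferentiableAt ℝ X u) (hY : DifferentiableAt ℝ Y u) (i : Fin m) :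
    covDeriv g F i (fun v => X v - Y v) u = covDeriv g F i X u - covDeriv g F i Y u := by
  simp only [covDeriv_eq, pd_sub hX hY]
  ext k
  simp [chris, mul_sub, Finset.sum_sub_distrib]; ring

theorem covDeriv_smul {p : (Fin m → ℝ) → ℝ} (hp : DifferentiableAt ℝ p u)
    (hX : DifferentiableAt ℝ X u) (i : Fin m) :
    covDeriv g F i (fun v => p v • X v) u = pd i p u • X u + p u • covDeriv g F i X u := by
  simp only [covDeriv_eq, pd_smul hp hX]
  ext k
  simp only [chris, Pi.add_apply, Pi.smul_apply, smul_eq_mul, mul_add, Finset.mul_sum, add_assoc]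
  congr 2
  exact Finset.sum_congr rfl fun a _ => Finset.sum_congr rfl fun b _ => by ring

theorem covDeriv_sum {ι : Type*} {s : Finset ι} {Z : ι → (Fin m → ℝ) → (Fin n → ℝ)}
    (hZ : ∀ a ∈ s, DifferentiableAt ℝ (Z a) u) (i : Fin m) :
    covDeriv g F i (fun v => ∑ a ∈ s, Z a v) u = ∑ a ∈ s, covDeriv g F i (Z a) u := by
  simp only [covDeriv_eq, pd_sum hZ, Finset.sum_add_distrib]
  congr 1
  ext k
  simp only [chris, Finset.sum_apply, Finset.mul_sum]
  rw [Finset.sum_congr rfl fun a _ => Finset.sum_comm, Finset.sum_comm]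

theorem covDeriv_congr {V : Set (Fin m → ℝ)} (hV : IsOpen V) (hu : u ∈ V)
    (h : ∀ v ∈ V, X v = Y v) (i : Fin m) : covDeriv g F i X u = covDeriv g F i Y u := by
  rw [covDeriv_eq, covDeriv_eq, pd_congr hV hu h, h u hu]

variable (g F u) in
theorem isLinearMap_tangential : IsLinearMap ℝ (tangential g F u) where
  map_add v w := by
    simp only [tangential, inner_add_left, mul_add, add_smul, Finset.sum_add_distrib]
  map_smul r v := by
    simp only [tangential, inner_smul_left, Finset.smul_sum, smul_smul]
    exact Finset.sum_congr rfl fun a _ => Finset.sum_congr rfl fun b _ => by congr 1; ring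

variable (g F u) in
theorem isLinearMap_normal : IsLinearMap ℝ (normal g F u) where
  map_add v w := by
    simp only [normal, (isLinearMap_tangential g F u).map_add]; abel
  map_smul r v := by
    simp only [normal, (isLinearMap_tangential g F u).map_smul, smul_sub]

theorem normal_sum {ι : Type*} (s : Finset ι) (v : ι → Fin n → ℝ) :
    normal g F u (∑ a ∈ s, v a) = ∑ a ∈ s, normal g F u (v a) :=
  map_sum (isLinearMap_normal g F u).mk' v s

theorem tangential_eq (v : Fin n → ℝ) :
    tangential g F u v
      = ∑ k, (∑ l, (induced g F u)⁻¹ k l * inner g (F u) v (pd l F u)) • pd k F u := by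
  simp only [tangential, Finset.sum_smul]

variable (g F u X) in
/-- The coefficients of the tangential part `∑ k, weingarten g F u X i k • ∂_k F` of `∇_{∂_i} X`.
For a normal field `X` this tangential part is `-A_X ∂_i`, where `A_X` is the shape operator. -/
def weingarten : Matrix (Fin m) (Fin m) ℝ := Matrix.of fun i k =>
  ∑ l, (induced g F u)⁻¹ k l * inner g (F u) (covDeriv g F i X u) (pd l F u)

theorem tangential_covDeriv (i : Fin m) :
    tangential g F u (covDeriv g F i X u) = ∑ k, weingarten g F u X i k • pd k F u :=
  tangential_eq _

theorem tangential_add_normal (v : Fin n → ℝ) :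
    tangential g F u v + normal g F u v = v := by simp [normal]

theorem tangential_eq_zero {v : Fin n → ℝ} (h : ∀ l, inner g (F u) v (pd l F u) = 0) :
    tangential g F u v = 0 := by simp [tangential, h]

namespace IsSubmanifoldOn
variable (S : IsSubmanifoldOn g D F U)
include S

theorem contDiffOn_pd' (i : Fin m) : ContDiffOn ℝ ∞ (pd i F) U :=
  contDiffOn_pd S.isOpen S.contDiffOn i

theorem isMetricOn_induced : IsMetricOn (induced g F) U where
  isOpen := S.isOpen
  contDiffOn a b := S.isMetricOn.contDiffOn_inner S.contDiffOn S.mapsTo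
    (S.contDiffOn_pd' a) (S.contDiffOn_pd' b)
  symm v hv := by
    ext a b
    exact inner_comm (S.isMetricOn.symm _ (S.mapsTo hv)) _ _
  isUnit_det := S.isUnit_det

theorem inner_comm' (hu : u ∈ U) (v w : Fin n → ℝ) : inner g (F u) v w = inner g (F u) w v :=
  inner_comm (S.isMetricOn.symm _ (S.mapsTo hu)) v w

theorem inner_tangential (hu : u ∈ U) (v : Fin n → ℝ) (l : Fin m) :
    inner g (F u) (tangential g F u v) (pd l F u) = inner g (F u) v (pd l F u) := by
  have h1 : ∀ p, ∑ k, induced g F u l k * (induced g F u)⁻¹ k p = if l = p then 1 else 0 := by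
    intro p
    rw [← Matrix.mul_apply, Matrix.mul_nonsing_inv _ (S.isUnit_det u hu), Matrix.one_apply]
  rw [tangential_eq, inner_sum_left]
  calc _ = ∑ p, (∑ k, induced g F u l k * (induced g F u)⁻¹ k p)
          * inner g (F u) v (pd p F u) := by
        simp only [inner_smul_left, Finset.sum_mul]
        rw [Finset.sum_comm]
        refine Finset.sum_congr rfl fun p _ => Finset.sum_congr rfl fun k _ => ?_
        rw [show induced g F u l k = inner g (F u) (pd k F u) (pd l F u) from
          S.inner_comm' hu _ _]
        ring
    _ = _ := by simp [h1]

theorem inner_normal (hu : u ∈ U) (v : Fin n → ℝ) (l : Fin m) :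
    inner g (F u) (normal g F u v) (pd l F u) = 0 := by
  rw [normal, inner_sub_left, S.inner_tangential hu, sub_self]

omit S in
theorem _root_.Coord.inner_tangential_of_normal {v w : Fin n → ℝ}
    (hw : ∀ l, inner g (F u) (pd l F u) w = 0) : inner g (F u) (tangential g F u v) w = 0 := by
  rw [tangential_eq, inner_sum_left]
  simp [inner_smul_left, hw]

theorem tangential_sum_pd (hu : u ∈ U) (r : Fin m → ℝ) :
    tangential g F u (∑ k, r k • pd k F u) = ∑ k, r k • pd k F u := by
  have h1 : ∀ k p, ∑ l, (induced g F u)⁻¹ k l * induced g F u l p = if k = p then 1 else 0 := by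
    intro k p
    rw [← Matrix.mul_apply, Matrix.nonsing_inv_mul _ (S.isUnit_det u hu), Matrix.one_apply]
  rw [tangential_eq]
  refine Finset.sum_congr rfl fun k _ => ?_
  congr 1
  calc _ = ∑ p, (∑ l, (induced g F u)⁻¹ k l * induced g F u l p) * r p := by
        simp only [inner_sum_left, inner_smul_left, Finset.mul_sum, Finset.sum_mul]
        rw [Finset.sum_comm]
        refine Finset.sum_congr rfl fun p _ => Finset.sum_congr rfl fun l _ => ?_
        rw [show induced g F u l p = inner g (F u) (pd p F u) (pd l F u) from
          S.inner_comm' hu _ _]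
        ring
    _ = r k := by simp [h1]

theorem normal_sum_pd (hu : u ∈ U) (r : Fin m → ℝ) :
    normal g F u (∑ k, r k • pd k F u) = 0 := by
  rw [normal, S.tangential_sum_pd hu, sub_self]

theorem normal_pd (hu : u ∈ U) (l : Fin m) : normal g F u (pd l F u) = 0 := by
  have h := S.normal_sum_pd hu (Pi.single l 1)
  simpa [Pi.single_apply] using h

theorem contDiffOn_covDeriv (hX : ContDiffOn ℝ ∞ X U) (i : Fin m) :
    ContDiffOn ℝ ∞ (covDeriv g F i X) U :=
  S.isMetricOn.contDiffOn_covDeriv S.isOpen S.contDiffOn S.mapsTo hX i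

theorem contDiffOn_inner (hX : ContDiffOn ℝ ∞ X U) (hY : ContDiffOn ℝ ∞ Y U) :
    ContDiffOn ℝ ∞ (fun u => inner g (F u) (X u) (Y u)) U :=
  S.isMetricOn.contDiffOn_inner S.contDiffOn S.mapsTo hX hY

theorem contDiffOn_tangentialCoeff (hX : ContDiffOn ℝ ∞ X U) (k : Fin m) :
    ContDiffOn ℝ ∞
      (fun u => ∑ l, (induced g F u)⁻¹ k l * inner g (F u) (X u) (pd l F u)) U :=
  ContDiffOn.sum fun l _ => (S.isMetricOn_induced.contDiffOn_inv k l).mul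
    (S.contDiffOn_inner hX (S.contDiffOn_pd' l))

theorem contDiffOn_normal (hX : ContDiffOn ℝ ∞ X U) :
    ContDiffOn ℝ ∞ (fun u => normal g F u (X u)) U := by
  simp only [normal, tangential_eq]
  exact hX.sub (ContDiffOn.sum fun k _ =>
    (S.contDiffOn_tangentialCoeff hX k).smul (S.contDiffOn_pd' k))

theorem pd_inner (hX : ContDiffOn ℝ ∞ X U) (hY : ContDiffOn ℝ ∞ Y U) (hu : u ∈ U) (i : Fin m) :
    pd i (fun u => inner g (F u) (X u) (Y u)) u
      = inner g (F u) (covDeriv g F i X u) (Y u) + inner g (F u) (X u) (covDeriv g F i Y u) :=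
  S.isMetricOn.pd_inner (differentiableAt_of_contDiffOn S.isOpen S.contDiffOn hu)
    (S.mapsTo hu) (differentiableAt_of_contDiffOn S.isOpen hX hu)
    (differentiableAt_of_contDiffOn S.isOpen hY hu) i

theorem covDeriv_pd_comm (hu : u ∈ U) (i j : Fin m) :
    covDeriv g F i (pd j F) u = covDeriv g F j (pd i F) u :=
  S.isMetricOn.covDeriv_pd_comm S.isOpen S.contDiffOn S.mapsTo hu i j

theorem mono {V : Set (Fin m → ℝ)} (hV : IsOpen V) (hVU : V ⊆ U) : IsSubmanifoldOn g D F V :=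
  ⟨S.isMetricOn, hV, S.contDiffOn.mono hVU, S.mapsTo.mono_left hVU,
    fun v hv => S.isUnit_det v (hVU hv)⟩

/-- The tangential part of the ambient connection is the connection of the induced metric. -/
theorem inner_covDeriv_pd (hu : u ∈ U) (i j l : Fin m) :
    inner g (F u) (covDeriv g F i (pd j F) u) (pd l F u)
      = ∑ k, induced g F u k l * christoffel (induced g F) u k i j := by
  rw [S.isMetricOn_induced.sum_mul_christoffel hu]
  have h : ∀ a b c, pd a (fun v => induced g F v b c) u
      = inner g (F u) (covDeriv g F a (pd b F) u) (pd c F u)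
        + inner g (F u) (pd b F u) (covDeriv g F a (pd c F) u) := fun a b c =>
    S.pd_inner (S.contDiffOn_pd' b) (S.contDiffOn_pd' c) hu a
  rw [h, h, h, S.covDeriv_pd_comm hu j i, S.covDeriv_pd_comm hu l i, S.covDeriv_pd_comm hu l j,
    S.inner_comm' hu (pd j F u), S.inner_comm' hu (pd i F u) (covDeriv g F j (pd l F) u)]
  ring

/-- The Gauss formula. -/
theorem covDeriv_pd_eq (hu : u ∈ U) (i j : Fin m) :
    covDeriv g F i (pd j F) u
      = secondForm g F i j u + ∑ k, christoffel (induced g F) u k i j • pd k F u := by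
  have h : tangential g F u (covDeriv g F i (pd j F) u)
      = ∑ k, christoffel (induced g F) u k i j • pd k F u := by
    rw [← S.tangential_sum_pd hu]
    simp only [tangential, S.inner_covDeriv_pd hu, inner_sum_left, inner_smul_left]
    refine Finset.sum_congr rfl fun a _ => Finset.sum_congr rfl fun b _ => ?_
    congr 2
    exact Finset.sum_congr rfl fun k _ => mul_comm _ _
  rw [← h, secondForm, add_comm, tangential_add_normal]

theorem secondForm_symm (hu : u ∈ U) (i j : Fin m) :
    secondForm g F i j u = secondForm g F j i u := by
  rw [secondForm, S.covDeriv_pd_comm hu, secondForm]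

theorem inner_secondForm_pd (hu : u ∈ U) (i j l : Fin m) :
    inner g (F u) (secondForm g F i j u) (pd l F u) = 0 := S.inner_normal hu _ l

theorem contDiffOn_secondForm (i j : Fin m) : ContDiffOn ℝ ∞ (secondForm g F i j) U :=
  S.contDiffOn_normal (S.contDiffOn_covDeriv (S.contDiffOn_pd' j) i)

theorem tension_eq (hu : u ∈ U) :
    tension g F u = ∑ i, ∑ j, (induced g F u)⁻¹ i j • secondForm g F i j u := by
  unfold tension
  refine Finset.sum_congr rfl fun i _ => Finset.sum_congr rfl fun j _ => ?_
  rw [S.covDeriv_pd_eq hu, add_sub_cancel_right]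

theorem tension_eq_smul [NeZero m] (hu : u ∈ U) :
    tension g F u = (m : ℝ) • meanCurvature g F u := by
  rw [S.tension_eq hu, meanCurvature, smul_smul, mul_one_div_cancel (NeZero.ne _), one_smul]

theorem contDiffOn_tension : ContDiffOn ℝ ∞ (tension g F) U := by
  have h : ContDiffOn ℝ ∞
      (fun v => ∑ i, ∑ j, (induced g F v)⁻¹ i j • secondForm g F i j v) U :=
    ContDiffOn.sum fun i _ => ContDiffOn.sum fun j _ =>
      (S.isMetricOn_induced.contDiffOn_inv i j).smul (S.contDiffOn_secondForm i j)
  exact h.congr fun v hv => S.tension_eq hv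

theorem inner_tension_pd (hu : u ∈ U) (l : Fin m) :
    inner g (F u) (tension g F u) (pd l F u) = 0 := by
  simp [S.tension_eq hu, inner_sum_left, inner_smul_left, S.inner_secondForm_pd hu]

/-- The Weingarten formula. -/
theorem inner_covDeriv_normal (hX : ContDiffOn ℝ ∞ X U)
    (hN : ∀ v ∈ U, ∀ l, inner g (F v) (X v) (pd l F v) = 0) (hu : u ∈ U) (i j : Fin m) :
    inner g (F u) (covDeriv g F i X u) (pd j F u)
      = -inner g (F u) (X u) (secondForm g F i j u) := by
  have h := S.pd_inner hX (S.contDiffOn_pd' j) hu i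
  have h0 : pd i (fun u => inner g (F u) (X u) (pd j F u)) u = 0 := by
    rw [pd_congr S.isOpen hu (G := fun _ => (0 : ℝ)) (fun v hv => hN v hv j)]
    simp [pd]
  rw [h0, S.covDeriv_pd_eq hu, inner_add_right, inner_sum_right] at h
  simp only [inner_smul_right, hN u hu, mul_zero, Finset.sum_const_zero, add_zero] at h
  linarith

/-- The normal curvature in terms of the ambient curvature, the second fundamental form and the
tangential part of the derivative of the field. -/
theorem normalCurvature_eq (hX : ContDiffOn ℝ ∞ X U) (hu : u ∈ U) (i j : Fin m) :
    normalCurvature g F i j X u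
      = normal g F u (curvature g (F u) (pd i F u) (pd j F u) (X u))
        + ∑ k, (weingarten g F u X i k • secondForm g F j k u
          - weingarten g F u X j k • secondForm g F i k u) := by
  have key : ∀ i j, normalConn g F i (normalConn g F j X) u
      = normal g F u (covDeriv g F i (covDeriv g F j X) u)
        - ∑ k, weingarten g F u X j k • secondForm g F i k u := by
    intro i j
    have hc := S.contDiffOn_covDeriv hX j
    have hs : ∀ k, ContDiffOn ℝ ∞ (fun u => weingarten g F u X j k • pd k F u) U := fun k =>
      (S.contDiffOn_tangentialCoeff hc k).smul (S.contDiffOn_pd' k)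
    have h1 : normalConn g F j X = fun u => covDeriv g F j X u
        - ∑ k, weingarten g F u X j k • pd k F u := by
      funext v
      rw [normalConn, normal, tangential_covDeriv]
    have d := fun {Z : (Fin m → ℝ) → (Fin n → ℝ)} (hZ : ContDiffOn ℝ ∞ Z U) =>
      differentiableAt_of_contDiffOn S.isOpen hZ hu
    rw [h1, normalConn, covDeriv_sub (d hc) (d (ContDiffOn.sum fun k _ => hs k)),
      covDeriv_sum (fun k _ => d (hs k)), (isLinearMap_normal g F u).map_sub, normal_sum]
    congr 1
    refine Finset.sum_congr rfl fun k _ => ?_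
    have hw : DifferentiableAt ℝ (fun u => weingarten g F u X j k) u :=
      differentiableAt_of_contDiffOn S.isOpen (S.contDiffOn_tangentialCoeff hc k) hu
    rw [covDeriv_smul hw (d (S.contDiffOn_pd' k)),
      (isLinearMap_normal g F u).map_add, (isLinearMap_normal g F u).map_smul,
      (isLinearMap_normal g F u).map_smul, S.normal_pd hu, smul_zero, zero_add, secondForm]
  rw [normalCurvature, key, key, ← S.isMetricOn.covDeriv_covDeriv_sub S.isOpen S.contDiffOn
    S.mapsTo hX hu, (isLinearMap_normal g F u).map_sub, Finset.sum_sub_distrib]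
  abel

theorem inv_induced_symm (hu : u ∈ U) : (induced g F u)⁻¹.IsSymm := by
  rw [Matrix.IsSymm, Matrix.transpose_nonsing_inv, (S.isMetricOn_induced.symm u hu).eq]

theorem weingarten_eq_mul (hX : ContDiffOn ℝ ∞ X U)
    (hN : ∀ v ∈ U, ∀ l, inner g (F v) (X v) (pd l F v) = 0) (hu : u ∈ U) :
    weingarten g F u X
      = (Matrix.of fun i j => -inner g (F u) (X u) (secondForm g F i j u))
        * (induced g F u)⁻¹ := by
  ext i k
  simp only [weingarten, Matrix.of_apply, S.inner_covDeriv_normal hX hN hu, Matrix.mul_apply]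
  exact Finset.sum_congr rfl fun l _ => by rw [(S.inv_induced_symm hu).apply l k, mul_comm]

/-- The shape operator of a normal field is a combination of the endomorphisms defined by the
coordinates of the second fundamental form. -/
theorem weingarten_eq_sum (hX : ContDiffOn ℝ ∞ X U)
    (hN : ∀ v ∈ U, ∀ l, inner g (F v) (X v) (pd l F v) = 0) (hu : u ∈ U) :
    weingarten g F u X = -∑ q, (∑ p, g (F u) p q * X u p) •
      ((Matrix.of fun i j => secondForm g F i j u q) * (induced g F u)⁻¹) := by
  have h : (Matrix.of fun i j => -inner g (F u) (X u) (secondForm g F i j u))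
      = -∑ q, (∑ p, g (F u) p q * X u p) • Matrix.of fun i j => secondForm g F i j u q := by
    ext i j
    rw [Matrix.neg_apply, Matrix.sum_apply, Matrix.of_apply, inner, Finset.sum_comm]
    simp only [Matrix.smul_apply, Matrix.of_apply, smul_eq_mul, Finset.sum_mul]
  rw [S.weingarten_eq_mul hX hN hu, h, Matrix.neg_mul, Finset.sum_mul]
  simp only [Matrix.smul_mul]

/-- If `∇^⊥ τ = 0`, then the tangential part of `Δτ` is a trace of the ambient curvature: by the
Codazzi equation the divergence of `⟨h, τ⟩` differs by such a trace from the derivative of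
`⟨τ, τ⟩`, which is constant. -/
theorem inner_roughLaplacian_tension
    (hpar : ∀ v ∈ U, ∀ i, normalConn g F i (tension g F) v = 0) (hu : u ∈ U) (l : Fin m) :
    inner g (F u) (roughLaplacian g F (tension g F) u) (pd l F u)
      = ∑ i, ∑ j, (induced g F u)⁻¹ i j *
        inner g (F u) (curvature g (F u) (pd i F u) (pd l F u) (tension g F u)) (pd j F u) := by
  set τ := tension g F with hτ
  have sτ : ContDiffOn ℝ ∞ τ U := S.contDiffOn_tension
  have nτ : ∀ v ∈ U, ∀ l, inner g (F v) (τ v) (pd l F v) = 0 := fun v hv l =>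
    S.inner_tension_pd hv l
  have tan : ∀ v ∈ U, ∀ i, covDeriv g F i τ v = tangential g F v (covDeriv g F i τ v) := by
    intro v hv i
    have h := hpar v hv i
    rw [normalConn, normal, sub_eq_zero] at h
    exact h
  -- The form `a = -⟨τ, h⟩`, whose symmetry and trace come from those of `h`.
  let a : Fin m → Fin m → (Fin m → ℝ) → ℝ := fun i j v =>
    inner g (F v) (covDeriv g F i τ v) (pd j F v)
  have sa : ∀ i j, ContDiffOn ℝ ∞ (a i j) U := fun i j =>
    S.contDiffOn_inner (S.contDiffOn_covDeriv sτ i) (S.contDiffOn_pd' j)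
  have da : ∀ i j, DifferentiableAt ℝ (a i j) u := fun i j =>
    differentiableAt_of_contDiffOn S.isOpen (sa i j) hu
  have aw : ∀ v ∈ U, ∀ i j, a i j v = -inner g (F v) (τ v) (secondForm g F i j v) :=
    fun v hv i j => S.inner_covDeriv_normal sτ nτ hv i j
  have asymm : ∀ v ∈ U, ∀ i j, a i j v = a j i v := fun v hv i j => by
    rw [aw v hv, aw v hv, S.secondForm_symm hv]
  -- Since `∇_jτ` is tangential, only the tangential part of `∇_i∂_l` contributes.
  have h1 : ∀ i j l, inner g (F u) (covDeriv g F i (covDeriv g F j τ) u) (pd l F u)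
      = pd i (a j l) u - ∑ k, christoffel (induced g F) u k i l * a j k u := by
    intro i j l
    have e := S.pd_inner (S.contDiffOn_covDeriv sτ j) (S.contDiffOn_pd' l) hu i
    have e2 : inner g (F u) (covDeriv g F j τ u) (secondForm g F i l u) = 0 := by
      rw [tan u hu j]
      exact inner_tangential_of_normal fun k => by
        rw [S.inner_comm' hu, S.inner_secondForm_pd hu]
    rw [S.covDeriv_pd_eq hu i l, inner_add_right, e2, inner_sum_right] at e
    simp only [inner_smul_right, zero_add] at e
    exact eq_sub_of_add_eq e.symm
  -- The Codazzi equation in the direction of `τ`.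
  have h2 : ∀ i j, pd i (a l j) u - ∑ k, christoffel (induced g F) u k i j * a l k u
      = inner g (F u) (curvature g (F u) (pd i F u) (pd l F u) (τ u)) (pd j F u)
        + (pd l (a i j) u - ∑ k, christoffel (induced g F) u k l j * a i k u) := by
    intro i j
    rw [← S.isMetricOn.covDeriv_covDeriv_sub S.isOpen S.contDiffOn S.mapsTo sτ hu i l,
      inner_sub_left, h1, h1]
    ring
  -- The trace of `a` is `-⟨τ, τ⟩`, which is constant.
  have h3 : pd l (fun v => ∑ i, ∑ j, (induced g F v)⁻¹ i j * a i j v) u = 0 := by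
    have e : ∀ v ∈ U, ∑ i, ∑ j, (induced g F v)⁻¹ i j * a i j v
        = (-1 : ℝ) * inner g (F v) (τ v) (τ v) := by
      intro v hv
      have e : inner g (F v) (τ v) (τ v)
          = inner g (F v) (τ v) (∑ i, ∑ j, (induced g F v)⁻¹ i j • secondForm g F i j v) :=
        congrArg _ (S.tension_eq hv)
      rw [e, inner_sum_right, Finset.mul_sum]
      refine Finset.sum_congr rfl fun i _ => ?_
      rw [inner_sum_right, Finset.mul_sum]
      refine Finset.sum_congr rfl fun j _ => ?_
      rw [aw v hv, inner_smul_right]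
      ring
    have e2 : inner g (F u) (covDeriv g F l τ u) (τ u) = 0 := by
      rw [tan u hu]
      exact inner_tangential_of_normal fun k => by rw [S.inner_comm' hu, nτ u hu]
    rw [pd_congr S.isOpen hu e, pd_mul (differentiableAt_const _)
      (differentiableAt_of_contDiffOn S.isOpen (S.contDiffOn_inner sτ sτ) hu),
      S.pd_inner sτ sτ hu, S.inner_comm' hu (τ u) (covDeriv g F l τ u), e2]
    simp [pd]
  rw [S.isMetricOn_induced.pd_trace hu da] at h3
  refine Eq.trans ?_ (add_zero _)
  rw [← h3, ← Finset.sum_add_distrib, roughLaplacian, inner_sum_left]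
  refine Finset.sum_congr rfl fun i _ => ?_
  rw [← Finset.sum_add_distrib, inner_sum_left]
  refine Finset.sum_congr rfl fun j _ => ?_
  rw [inner_smul_left, inner_sub_left, h1, inner_sum_left, ← mul_add]
  congr 1
  have h4 := h2 i j
  have e1 : pd i (a j l) u = pd i (a l j) u :=
    pd_congr S.isOpen hu (fun v hv => asymm v hv j l) i
  have e2 : ∑ k, inner g (F u) (christoffel (induced g F) u k i j • covDeriv g F k τ u) (pd l F u)
      = ∑ k, christoffel (induced g F) u k i j * a l k u :=
    Finset.sum_congr rfl fun k _ => by rw [inner_smul_left, asymm u hu l k]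
  have e3 : ∑ k, christoffel (induced g F) u k i l * a j k u
      = ∑ k, christoffel (induced g F) u k l i * a k j u :=
    Finset.sum_congr rfl fun k _ => by
      rw [asymm u hu k j, S.isMetricOn_induced.christoffel_symm hu]
  rw [e1, e2, e3]
  linarith

end IsSubmanifoldOn
end Submanifold
/-! ### Diagonal metrics and directional derivatives -/

section Diagonal
variable {n : ℕ} {g : (Fin n → ℝ) → Matrix (Fin n) (Fin n) ℝ} {D : Set (Fin n → ℝ)}
  {x : Fin n → ℝ}

theorem inner_of_diagonal {e : Fin n → ℝ} (hg : g x = Matrix.diagonal e) (v w : Fin n → ℝ) :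
    inner g x v w = ∑ a, e a * v a * w a := by
  simp [inner, hg, Matrix.diagonal_apply]

theorem chris_of_diagonal {η : Fin n → (Fin n → ℝ) → ℝ} (hD : IsOpen D)
    (hg : ∀ x ∈ D, g x = Matrix.diagonal fun a => η a x) (hη : ∀ a, η a x ≠ 0) (hx : x ∈ D)
    (v w : Fin n → ℝ) (k : Fin n) :
    chris g x v w k = 1 / (2 * η k x) *
      (fderiv ℝ (η k) x v * w k + fderiv ℝ (η k) x w * v k - ∑ a, pd k (η a) x * v a * w a) := by
  have hinv : (g x)⁻¹ = Matrix.diagonal fun a => (η a x)⁻¹ := by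
    refine Matrix.inv_eq_right_inv ?_
    rw [hg x hx, Matrix.diagonal_mul_diagonal, ← Matrix.diagonal_one]
    congr 1
    funext a
    exact mul_inv_cancel₀ (hη a)
  have hpd : ∀ i a b, pd i (fun y => g y a b) x = if a = b then pd i (η a) x else 0 := by
    intro i a b
    rw [pd_congr hD hx (G := fun y => if a = b then η a y else 0) fun y hy => by
      rw [hg y hy, Matrix.diagonal_apply]]
    split_ifs
    · rfl
    · simp [pd]
  have hchr : ∀ i j, christoffel g x k i j = 1 / (2 * η k x) *
      ((if j = k then pd i (η k) x else 0) + (if i = k then pd j (η k) x else 0)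
        - if i = j then pd k (η i) x else 0) := by
    intro i j
    have e : ∀ a, (if a = k then pd i (η a) x else 0) = if a = k then pd i (η k) x else 0 := by
      intro a; split_ifs with h
      · rw [h]
      · rfl
    have e' : ∀ a, (if a = k then pd j (η a) x else 0) = if a = k then pd j (η k) x else 0 := by
      intro a; split_ifs with h
      · rw [h]
      · rfl
    unfold christoffel
    rw [hinv, Finset.sum_eq_single k]
    · rw [Matrix.diagonal_apply_eq, hpd, hpd, hpd, e, e']
      field_simp
    · intro b _ hb
      rw [Matrix.diagonal_apply_ne _ hb.symm, zero_mul]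
    · simp
  simp only [chris, hchr, fderiv_eq_sum_pd]
  have e0 : ∀ i j, 1 / (2 * η k x) *
      ((if j = k then pd i (η k) x else 0) + (if i = k then pd j (η k) x else 0)
        - if i = j then pd k (η i) x else 0) * v i * w j
      = 1 / (2 * η k x) * (((if j = k then v i * pd i (η k) x * w k else 0)
        + (if i = k then w j * pd j (η k) x * v k else 0))
        - if i = j then pd k (η i) x * v i * w i else 0) := by
    intro i j
    split_ifs <;> subst_vars <;> ring
  simp only [e0, ← Finset.mul_sum]
  congr 1
  simp only [Finset.sum_sub_distrib, Finset.sum_add_distrib]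
  congr 1
  · congr 1
    · simp [Finset.sum_mul]
    · rw [Finset.sum_comm]
      simp [Finset.sum_mul]
  · simp

theorem IsMetricOn.dchris_eq (hg : IsMetricOn g D) (hx : x ∈ D) (z v w : Fin n → ℝ)
    (k : Fin n) : dchris g x z v w k = fderiv ℝ (fun y => chris g y v w k) x z := by
  have d : ∀ a b, DifferentiableAt ℝ (fun y => christoffel g y k a b) x := fun a b =>
    differentiableAt_of_contDiffOn hg.isOpen (hg.contDiffOn_christoffel k a b) hx
  have d' : ∀ a b, DifferentiableAt ℝ (fun y => christoffel g y k a b * v a * w b) x :=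
    fun a b => ((d a b).mul_const _).mul_const _
  unfold chris dchris
  rw [fderiv_fun_sum fun a _ => DifferentiableAt.fun_sum fun b _ => d' a b]
  simp only [sum_apply]
  refine Finset.sum_congr rfl fun a _ => ?_
  rw [fderiv_fun_sum fun b _ => d' a b]
  simp only [sum_apply]
  refine Finset.sum_congr rfl fun b _ => ?_
  rw [fderiv_mul_const ((d a b).mul_const _), fderiv_mul_const (d a b)]
  simp; ring

/-- A directional derivative is a derivative along a line. -/
theorem fderiv_eq_of_hasDerivAt {E : Type*} [NormedAddCommGroup E] [NormedSpace ℝ E]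
    {G : (Fin n → ℝ) → E} (hG : DifferentiableAt ℝ G x) {v : Fin n → ℝ} {G' : E}
    (h : HasDerivAt (fun s : ℝ => G (x + s • v)) G' 0) : fderiv ℝ G x v = G' := by
  have hl : HasDerivAt (fun s : ℝ => x + s • v) v 0 := by
    simpa using ((hasDerivAt_id (0 : ℝ)).smul_const v).const_add x
  have hG' : HasFDerivAt G (fderiv ℝ G x) (x + (0 : ℝ) • v) := by
    simpa using hG.hasFDerivAt
  exact (hG'.comp_hasDerivAt (0 : ℝ) hl).unique h

end Diagonal
end Coord

/-! ### The metric of a Robertson-Walker space in stereographic coordinates -/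

namespace RW
open Coord

section Metric
variable {d : ℕ}

/-- The Euclidean product of the space components of `v` and `w`. -/
def sdot (v w : Fin (d + 1) → ℝ) : ℝ := ∑ i : Fin d, v i.succ * w i.succ

/-- The factor `1 + c|x|²/4` in the stereographic coordinates of the space form. -/
def stereoFactor (c : ℝ) (x : Fin (d + 1) → ℝ) : ℝ := 1 + c * sdot x x / 4

/-- A coordinate domain of the Robertson-Walker space with interval `I`. -/
def domain (I : Set ℝ) (c : ℝ) (d : ℕ) : Set (Fin (d + 1) → ℝ) :=
  {x | x 0 ∈ I ∧ stereoFactor c x ≠ 0}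

/-- The factor `f²/(1 + c|x|²/4)²` of the Euclidean metric in the space components. -/
def spaceFactor (f : ℝ → ℝ) (c : ℝ) (x : Fin (d + 1) → ℝ) : ℝ :=
  f (x 0) ^ 2 / stereoFactor c x ^ 2

/-- The function `μ = c/(2ρ)`, for which `d(log ρ) = μ ⟨x, dx⟩` where `ρ = 1 + c|x|²/4`. -/
def stereoLog (c : ℝ) (x : Fin (d + 1) → ℝ) : ℝ := c / (2 * stereoFactor c x)

theorem sdot_comm (v w : Fin (d + 1) → ℝ) : sdot v w = sdot w v :=
  Finset.sum_congr rfl fun _ _ => mul_comm _ _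

theorem sdot_self_pos {v : Fin (d + 1) → ℝ} (h0 : v 0 = 0) (hv : v ≠ 0) : 0 < sdot v v := by
  obtain ⟨a, ha⟩ := Function.ne_iff.1 hv
  obtain ⟨i, rfl⟩ := Fin.exists_succ_eq.2 (show a ≠ 0 by rintro rfl; exact ha h0)
  exact Finset.sum_pos' (fun j _ => mul_self_nonneg _) ⟨i, Finset.mem_univ _, mul_self_pos.2 ha⟩

theorem contDiff_stereoFactor (c : ℝ) : ContDiff ℝ ∞ (stereoFactor (d := d) c) := by
  unfold stereoFactor sdot
  fun_prop

theorem hasDerivAt_line (x z : Fin (d + 1) → ℝ) (a : Fin (d + 1)) :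
    HasDerivAt (fun s : ℝ => (x + s • z) a) (z a) 0 := by
  simpa using ((hasDerivAt_id (0 : ℝ)).mul_const (z a)).const_add (x a)

theorem hasDerivAt_sdot_line (x z v : Fin (d + 1) → ℝ) :
    HasDerivAt (fun s : ℝ => sdot (x + s • z) v) (sdot z v) 0 :=
  HasDerivAt.fun_sum fun i _ => (hasDerivAt_line x z i.succ).mul_const _

theorem hasDerivAt_stereoFactor_line (c : ℝ) (x z : Fin (d + 1) → ℝ) :
    HasDerivAt (fun s : ℝ => stereoFactor c (x + s • z)) (c / 2 * sdot x z) 0 := by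
  have h : HasDerivAt (fun s : ℝ => sdot (x + s • z) (x + s • z)) (2 * sdot x z) 0 := by
    have := HasDerivAt.fun_sum (u := Finset.univ) fun (i : Fin d) _ =>
      (hasDerivAt_line x z i.succ).mul (hasDerivAt_line x z i.succ)
    refine this.congr_deriv ?_
    simp only [sdot, Finset.mul_sum, zero_smul, add_zero]
    exact Finset.sum_congr rfl fun i _ => by ring
  exact (((h.const_mul c).div_const 4).const_add 1).congr_deriv (by ring)

theorem hasDerivAt_stereoLog_line {c : ℝ} {x : Fin (d + 1) → ℝ} (hx : stereoFactor c x ≠ 0)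
    (z : Fin (d + 1) → ℝ) :
    HasDerivAt (fun s : ℝ => stereoLog c (x + s • z)) (-stereoLog c x ^ 2 * sdot x z) 0 := by
  have h := ((hasDerivAt_const (0 : ℝ) c).div ((hasDerivAt_stereoFactor_line c x z).const_mul 2)
    (by simpa using hx))
  refine h.congr_deriv ?_
  simp only [stereoLog, zero_smul, add_zero]
  field_simp
  ring

theorem hasDerivAt_spaceFactor_line {f : ℝ → ℝ} {c : ℝ} {x : Fin (d + 1) → ℝ}
    (hx : stereoFactor c x ≠ 0) (hf : DifferentiableAt ℝ f (x 0)) (hf0 : f (x 0) ≠ 0)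
    (z : Fin (d + 1) → ℝ) :
    HasDerivAt (fun s : ℝ => spaceFactor f c (x + s • z))
      (2 * spaceFactor f c x * (deriv f (x 0) / f (x 0) * z 0 - stereoLog c x * sdot x z)) 0 := by
  have hf' : HasDerivAt f (deriv f (x 0)) ((x + (0 : ℝ) • z) 0) := by simpa using hf.hasDerivAt
  have h1 := hf'.comp (0 : ℝ) (hasDerivAt_line x z 0)
  have h := (h1.pow 2).div ((hasDerivAt_stereoFactor_line c x z).pow 2)
    (by simpa using hx)
  refine h.congr_deriv ?_
  simp only [spaceFactor, stereoLog, Function.comp, Pi.pow_apply, zero_smul, add_zero]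
  field_simp
  ring

theorem hasDerivAt_logDeriv_line {f : ℝ → ℝ} {x : Fin (d + 1) → ℝ}
    (hf : DifferentiableAt ℝ f (x 0)) (hf' : DifferentiableAt ℝ (deriv f) (x 0))
    (hf0 : f (x 0) ≠ 0) (z : Fin (d + 1) → ℝ) :
    HasDerivAt (fun s : ℝ => deriv f ((x + s • z) 0) / f ((x + s • z) 0))
      ((deriv (deriv f) (x 0) / f (x 0) - (deriv f (x 0) / f (x 0)) ^ 2) * z 0) 0 := by
  have h1 : HasDerivAt f (deriv f (x 0)) ((x + (0 : ℝ) • z) 0) := by simpa using hf.hasDerivAt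
  have h2 : HasDerivAt (deriv f) (deriv (deriv f) (x 0)) ((x + (0 : ℝ) • z) 0) := by
    simpa using hf'.hasDerivAt
  have h := (h2.comp (0 : ℝ) (hasDerivAt_line x z 0)).div
    (h1.comp (0 : ℝ) (hasDerivAt_line x z 0)) (by simpa using hf0)
  refine h.congr_deriv ?_
  simp only [Function.comp, zero_smul, add_zero]
  field_simp

theorem differentiableAt_param {c ε : ℝ} {x : Fin (d + 1) → ℝ} (hx : stereoFactor c x ≠ 0) :
    DifferentiableAt ℝ (param c ε) x := by
  have hx' : 1 + c * (∑ i : Fin d, x i.succ ^ 2) / 4 ≠ 0 := by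
    simpa [stereoFactor, sdot, pow_two] using hx
  unfold param
  have hq : DifferentiableAt ℝ
      (fun x : Fin (d + 1) → ℝ => c * (∑ i : Fin d, x i.succ ^ 2) / 4) x := by
    simp only [div_eq_mul_inv]
    fun_prop
  refine DifferentiableAt.prodMk (by fun_prop) (DifferentiableAt.prodMk ?_
    (differentiableAt_pi.2 fun i => ?_))
  · simp only [div_eq_mul_inv]
    exact ((hq.const_sub 1).mul ((hq.const_add 1).fun_inv hx')).const_mul ε
  · simp only [div_eq_mul_inv]
    exact DifferentiableAt.mul (by fun_prop) ((hq.const_add 1).fun_inv hx')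

theorem param_eq (c ε : ℝ) (x : Fin (d + 1) → ℝ) :
    param c ε x = (x 0, ε * ((2 - stereoFactor c x) / stereoFactor c x),
      fun i => x i.succ / stereoFactor c x) := by
  have h : c * (∑ i : Fin d, x i.succ ^ 2) / 4 = stereoFactor c x - 1 := by
    simp [stereoFactor, sdot, pow_two]
  simp only [param, h]
  ring_nf

theorem pd_param {c ε : ℝ} {x : Fin (d + 1) → ℝ} (hx : stereoFactor c x ≠ 0)
    (a : Fin (d + 1)) :
    pd a (param c ε) x = ((Pi.single a 1 : Fin (d + 1) → ℝ) 0,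
      -(ε * c * sdot x (Pi.single a 1)) / stereoFactor c x ^ 2,
      fun i => (Pi.single a 1 : Fin (d + 1) → ℝ) i.succ / stereoFactor c x
        - x i.succ * (c / 2 * sdot x (Pi.single a 1)) / stereoFactor c x ^ 2) := by
  refine fderiv_eq_of_hasDerivAt (differentiableAt_param hx) ?_
  simp only [param_eq]
  set z : Fin (d + 1) → ℝ := Pi.single a 1
  have hρ := hasDerivAt_stereoFactor_line c x z
  have hx' : stereoFactor c (x + (0 : ℝ) • z) ≠ 0 := by simpa using hx
  refine (hasDerivAt_line x z 0).prodMk (HasDerivAt.prodMk ?_ (hasDerivAt_pi.2 fun i => ?_))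
  · refine (((hρ.const_sub 2).div hρ hx').const_mul ε).congr_deriv ?_
    simp only [zero_smul, add_zero]
    field_simp
    ring
  · refine ((hasDerivAt_line x z i.succ).div hρ hx').congr_deriv ?_
    simp only [zero_smul, add_zero]
    field_simp

/-- The diagonal entries of the metric. -/
def diagEntry (f : ℝ → ℝ) (c : ℝ) (a : Fin (d + 1)) (x : Fin (d + 1) → ℝ) : ℝ :=
  if a = 0 then -1 else spaceFactor f c x

theorem metric_eq_diagonal {f : ℝ → ℝ} {c ε : ℝ} (hc : c = 1 ∨ c = 0 ∨ c = -1)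
    (hε : ε = 1 ∨ ε = -1) {x : Fin (d + 1) → ℝ} (hx : stereoFactor c x ≠ 0) :
    metric f c ε x = Matrix.diagonal fun a => diagEntry f c a x := by
  -- The terms in `x_a x_b` cancel because `c³ = c`.
  have hcc : c * (c ^ 2 - 1) = 0 := by rcases hc with rfl | rfl | rfl <;> norm_num
  have hεε : ε ^ 2 = 1 := by rcases hε with rfl | rfl <;> norm_num
  have hρ : c * sdot x x = 4 * (stereoFactor c x - 1) := by unfold stereoFactor; ring
  have hform : ∀ v w : Fin (d + 1) → ℝ,
      ∑ i : Fin d, (v i.succ / stereoFactor c x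
          - x i.succ * (c / 2 * sdot x v) / stereoFactor c x ^ 2)
        * (w i.succ / stereoFactor c x - x i.succ * (c / 2 * sdot x w) / stereoFactor c x ^ 2)
      = sdot v w / stereoFactor c x ^ 2 - c * sdot x v * sdot x w / stereoFactor c x ^ 3
        + c ^ 2 / 4 * sdot x x * sdot x v * sdot x w / stereoFactor c x ^ 4 := by
    intro v w
    have e : ∀ i : Fin d, (v i.succ / stereoFactor c x
          - x i.succ * (c / 2 * sdot x v) / stereoFactor c x ^ 2)
        * (w i.succ / stereoFactor c x - x i.succ * (c / 2 * sdot x w) / stereoFactor c x ^ 2)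
        = v i.succ * w i.succ * (1 / stereoFactor c x ^ 2)
          - x i.succ * v i.succ * (c / 2 * sdot x w / stereoFactor c x ^ 3)
          - x i.succ * w i.succ * (c / 2 * sdot x v / stereoFactor c x ^ 3)
          + x i.succ * x i.succ * (c ^ 2 / 4 * sdot x v * sdot x w / stereoFactor c x ^ 4) := by
      intro i
      field_simp
      ring
    simp only [e, Finset.sum_add_distrib, Finset.sum_sub_distrib, ← Finset.sum_mul]
    have hs : ∀ p q : Fin (d + 1) → ℝ, ∑ i : Fin d, p i.succ * q i.succ = sdot p q :=
      fun _ _ => rfl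
    simp only [hs]
    ring
  ext a b
  rw [metric, Matrix.of_apply, form, pd_param hx, pd_param hx]
  simp only [hform]
  rw [show (param c ε x).1 = x 0 from rfl]
  set v : Fin (d + 1) → ℝ := Pi.single a 1 with hv
  set w : Fin (d + 1) → ℝ := Pi.single b 1 with hw
  have h1 : -(v 0 * w 0) + f (x 0) ^ 2 *
      (c * (-(ε * c * sdot x v) / stereoFactor c x ^ 2)
          * (-(ε * c * sdot x w) / stereoFactor c x ^ 2)
        + (sdot v w / stereoFactor c x ^ 2 - c * sdot x v * sdot x w / stereoFactor c x ^ 3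
        + c ^ 2 / 4 * sdot x x * sdot x v * sdot x w / stereoFactor c x ^ 4))
      = -(v 0 * w 0) + spaceFactor f c x * sdot v w := by
    unfold spaceFactor
    field_simp
    linear_combination (f (x 0) ^ 2 * c * 4 * sdot x v * sdot x w * c ^ 2) * hεε
      + (f (x 0) ^ 2 * 4 * sdot x v * sdot x w) * hcc
      + (f (x 0) ^ 2 * c * sdot x v * sdot x w) * hρ
  rw [h1, Matrix.diagonal_apply, diagEntry]
  cases a using Fin.cases <;> cases b using Fin.cases <;>
    simp [hv, hw, sdot, Pi.single_apply, Fin.succ_ne_zero, (Fin.succ_ne_zero _).symm, eq_comm]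

theorem spaceFactor_pos {f : ℝ → ℝ} {c : ℝ} {x : Fin (d + 1) → ℝ} (hx : stereoFactor c x ≠ 0)
    (hf0 : f (x 0) ≠ 0) : 0 < spaceFactor f c x := by
  unfold spaceFactor; positivity

theorem isOpen_domain {I : Set ℝ} (hI : IsOpen I) (c : ℝ) : IsOpen (domain I c d) :=
  (hI.preimage (continuous_apply 0)).inter
    ((contDiff_stereoFactor c).continuous.isOpen_preimage _ isOpen_ne)

variable {I : Set ℝ} {f : ℝ → ℝ} {c ε : ℝ} {x : Fin (d + 1) → ℝ}

theorem contDiffOn_diagEntry (hf : ContDiffOn ℝ ∞ f I) (a : Fin (d + 1)) :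
    ContDiffOn ℝ ∞ (diagEntry f c a) (domain I c d) := by
  unfold diagEntry
  split_ifs
  · exact contDiffOn_const
  · have h : ContDiffOn ℝ ∞ (fun x : Fin (d + 1) → ℝ => f (x 0)) (domain I c d) :=
      hf.comp (contDiff_apply ℝ ℝ 0).contDiffOn fun x hx => hx.1
    exact (h.pow 2).div ((contDiff_stereoFactor c).contDiffOn.pow 2) fun x hx =>
      pow_ne_zero _ hx.2

theorem diagEntry_ne_zero (hf0 : ∀ t ∈ I, f t ≠ 0) (hx : x ∈ domain I c d) (a : Fin (d + 1)) :
    diagEntry f c a x ≠ 0 := by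
  unfold diagEntry
  split_ifs
  · norm_num
  · exact (spaceFactor_pos hx.2 (hf0 _ hx.1)).ne'

theorem isMetricOn_metric (hI : IsOpen I) (hf : ContDiffOn ℝ ∞ f I) (hf0 : ∀ t ∈ I, f t ≠ 0)
    (hc : c = 1 ∨ c = 0 ∨ c = -1) (hε : ε = 1 ∨ ε = -1) :
    IsMetricOn (metric f c ε) (domain I c d) where
  isOpen := isOpen_domain hI c
  contDiffOn a b := by
    have h : ContDiffOn ℝ ∞ (fun x => if a = b then diagEntry f c a x else 0)
        (domain I c d) := by
      split_ifs
      · exact contDiffOn_diagEntry hf a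
      · exact contDiffOn_const
    exact h.congr fun x hx => by rw [metric_eq_diagonal hc hε hx.2, Matrix.diagonal_apply]
  symm x hx := by
    rw [metric_eq_diagonal hc hε hx.2]
    exact Matrix.isSymm_diagonal _
  isUnit_det x hx := by
    rw [metric_eq_diagonal hc hε hx.2, Matrix.det_diagonal, isUnit_iff_ne_zero]
    exact Finset.prod_ne_zero_iff.2 fun a _ => diagEntry_ne_zero hf0 hx a

theorem inner_metric (hc : c = 1 ∨ c = 0 ∨ c = -1) (hε : ε = 1 ∨ ε = -1)
    (hx : stereoFactor c x ≠ 0) (v w : Fin (d + 1) → ℝ) :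
    inner (metric f c ε) x v w = -(v 0 * w 0) + spaceFactor f c x * sdot v w := by
  rw [inner_of_diagonal (metric_eq_diagonal hc hε hx), Fin.sum_univ_succ]
  simp [diagEntry, sdot, Finset.mul_sum, mul_assoc]

/-- Half the logarithmic derivative of `spaceFactor` in the direction `v`. -/
def spaceLog (f : ℝ → ℝ) (c : ℝ) (x v : Fin (d + 1) → ℝ) : ℝ :=
  deriv f (x 0) / f (x 0) * v 0 - stereoLog c x * sdot x v

theorem fderiv_diagEntry (hI : IsOpen I) (hf : ContDiffOn ℝ ∞ f I) (hf0 : ∀ t ∈ I, f t ≠ 0)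
    (hx : x ∈ domain I c d) (a : Fin (d + 1)) (v : Fin (d + 1) → ℝ) :
    fderiv ℝ (diagEntry f c a) x v
      = if a = 0 then 0 else 2 * spaceFactor f c x * spaceLog f c x v := by
  have hd := differentiableAt_of_contDiffOn (isOpen_domain hI c)
    (contDiffOn_diagEntry (c := c) hf a) hx
  refine fderiv_eq_of_hasDerivAt hd ?_
  unfold diagEntry
  split_ifs
  · exact hasDerivAt_const _ _
  · exact hasDerivAt_spaceFactor_line hx.2
      ((hf.contDiffAt (hI.mem_nhds hx.1)).differentiableAt (by simp)) (hf0 _ hx.1) v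

theorem chris_metric_zero (hI : IsOpen I) (hf : ContDiffOn ℝ ∞ f I) (hf0 : ∀ t ∈ I, f t ≠ 0)
    (hc : c = 1 ∨ c = 0 ∨ c = -1) (hε : ε = 1 ∨ ε = -1) (hx : x ∈ domain I c d)
    (v w : Fin (d + 1) → ℝ) :
    chris (metric f c ε) x v w 0
      = deriv f (x 0) / f (x 0) * spaceFactor f c x * sdot v w := by
  rw [chris_of_diagonal (isOpen_domain hI c) (fun y hy => metric_eq_diagonal hc hε hy.2)
    (diagEntry_ne_zero hf0 hx) hx, Fin.sum_univ_succ]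
  simp only [pd, fderiv_diagEntry hI hf hf0 hx, Fin.succ_ne_zero, if_true, if_false, mul_assoc,
    ← Finset.mul_sum]
  simp [diagEntry, spaceLog, sdot]
  ring

theorem chris_metric_succ (hI : IsOpen I) (hf : ContDiffOn ℝ ∞ f I) (hf0 : ∀ t ∈ I, f t ≠ 0)
    (hc : c = 1 ∨ c = 0 ∨ c = -1) (hε : ε = 1 ∨ ε = -1) (hx : x ∈ domain I c d)
    (v w : Fin (d + 1) → ℝ) (i : Fin d) :
    chris (metric f c ε) x v w i.succ
      = spaceLog f c x v * w i.succ + spaceLog f c x w * v i.succ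
        + stereoLog c x * x i.succ * sdot v w := by
  have hs : spaceLog f c x (Pi.single i.succ 1) = -(stereoLog c x * x i.succ) := by
    simp [spaceLog, sdot, Pi.single_apply]
  have hp := (spaceFactor_pos hx.2 (hf0 _ hx.1)).ne'
  rw [chris_of_diagonal (isOpen_domain hI c) (fun y hy => metric_eq_diagonal hc hε hy.2)
    (diagEntry_ne_zero hf0 hx) hx, Fin.sum_univ_succ]
  simp only [pd, fderiv_diagEntry hI hf hf0 hx, Fin.succ_ne_zero, if_true, if_false, mul_assoc,
    ← Finset.mul_sum, hs, zero_mul, zero_add]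
  simp only [diagEntry, Fin.succ_ne_zero, if_false]
  rw [show sdot v w = ∑ j : Fin d, v j.succ * w j.succ from rfl]
  field_simp
  ring

end Metric
/-! ### The curvature of a Robertson-Walker space -/

section Curvature
variable {d : ℕ} {I : Set ℝ} {f : ℝ → ℝ} {c ε : ℝ} {x : Fin (d + 1) → ℝ}

theorem hasDerivAt_spaceLog_line (hI : IsOpen I) (hf : ContDiffOn ℝ ∞ f I)
    (hf0 : ∀ t ∈ I, f t ≠ 0) (hx : x ∈ domain I c d) (z v : Fin (d + 1) → ℝ) :
    HasDerivAt (fun s : ℝ => spaceLog f c (x + s • z) v)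
      ((deriv (deriv f) (x 0) / f (x 0) - (deriv f (x 0) / f (x 0)) ^ 2) * z 0 * v 0
        + stereoLog c x ^ 2 * sdot x z * sdot x v - stereoLog c x * sdot z v) 0 := by
  have hft := hf.contDiffAt (hI.mem_nhds hx.1)
  have hft' : DifferentiableAt ℝ (deriv f) (x 0) :=
    ((hf.deriv_of_isOpen (m := ∞) hI (by simp)).contDiffAt (hI.mem_nhds hx.1)).differentiableAt
      (by simp)
  have h := ((hasDerivAt_logDeriv_line (hft.differentiableAt (by simp)) hft'
    (hf0 _ hx.1) z).mul_const (v 0)).sub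
    ((hasDerivAt_stereoLog_line hx.2 z).mul (hasDerivAt_sdot_line x z v))
  refine h.congr_deriv ?_
  simp only [zero_smul, add_zero]
  ring

theorem dchris_metric_eq_of_hasDerivAt (hI : IsOpen I) (hf : ContDiffOn ℝ ∞ f I)
    (hf0 : ∀ t ∈ I, f t ≠ 0) (hc : c = 1 ∨ c = 0 ∨ c = -1) (hε : ε = 1 ∨ ε = -1)
    (hx : x ∈ domain I c d) (z v w : Fin (d + 1) → ℝ) (k : Fin (d + 1))
    {Γ : (Fin (d + 1) → ℝ) → ℝ} (hΓ : ∀ y ∈ domain I c d, chris (metric f c ε) y v w k = Γ y)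
    {Γ' : ℝ} (h : HasDerivAt (fun s : ℝ => Γ (x + s • z)) Γ' 0) :
    dchris (metric f c ε) x z v w k = Γ' := by
  have hg := isMetricOn_metric hI hf hf0 hc hε (d := d)
  rw [hg.dchris_eq hx]
  refine fderiv_eq_of_hasDerivAt (differentiableAt_of_contDiffOn hg.isOpen
    (contDiffOn_pi.1 (hg.contDiffOn_chris contDiffOn_id (Set.mapsTo_id _) contDiffOn_const
      contDiffOn_const) k) hx) (h.congr_of_eventuallyEq ?_)
  have hl : Continuous fun s : ℝ => x + s • z := by fun_prop
  filter_upwards [hl.continuousAt.preimage_mem_nhds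
    (hg.isOpen.mem_nhds (by simpa using hx : x + (0 : ℝ) • z ∈ domain I c d))] with s hs
  exact hΓ _ hs

theorem dchris_metric_zero (hI : IsOpen I) (hf : ContDiffOn ℝ ∞ f I) (hf0 : ∀ t ∈ I, f t ≠ 0)
    (hc : c = 1 ∨ c = 0 ∨ c = -1) (hε : ε = 1 ∨ ε = -1) (hx : x ∈ domain I c d)
    (z v w : Fin (d + 1) → ℝ) :
    dchris (metric f c ε) x z v w 0
      = ((deriv (deriv f) (x 0) / f (x 0) - (deriv f (x 0) / f (x 0)) ^ 2) * z 0
        + 2 * (deriv f (x 0) / f (x 0)) * spaceLog f c x z) * spaceFactor f c x * sdot v w := by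
  have hft := hf.contDiffAt (hI.mem_nhds hx.1)
  have hft' : DifferentiableAt ℝ (deriv f) (x 0) :=
    ((hf.deriv_of_isOpen (m := ∞) hI (by simp)).contDiffAt (hI.mem_nhds hx.1)).differentiableAt
      (by simp)
  have hfd := hft.differentiableAt (by simp)
  refine dchris_metric_eq_of_hasDerivAt hI hf hf0 hc hε hx z v w 0
    (fun y hy => chris_metric_zero hI hf hf0 hc hε hy v w)
    ((((hasDerivAt_logDeriv_line hfd hft' (hf0 _ hx.1) z).mul
      (hasDerivAt_spaceFactor_line hx.2 hfd (hf0 _ hx.1) z)).mul_const (sdot v w)).congr_deriv ?_)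
  simp only [zero_smul, add_zero, spaceLog]
  ring

theorem dchris_metric_succ (hI : IsOpen I) (hf : ContDiffOn ℝ ∞ f I) (hf0 : ∀ t ∈ I, f t ≠ 0)
    (hc : c = 1 ∨ c = 0 ∨ c = -1) (hε : ε = 1 ∨ ε = -1) (hx : x ∈ domain I c d)
    (z v w : Fin (d + 1) → ℝ) (i : Fin d) :
    dchris (metric f c ε) x z v w i.succ
      = ((deriv (deriv f) (x 0) / f (x 0) - (deriv f (x 0) / f (x 0)) ^ 2) * z 0 * v 0
        + stereoLog c x ^ 2 * sdot x z * sdot x v - stereoLog c x * sdot z v) * w i.succ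
      + ((deriv (deriv f) (x 0) / f (x 0) - (deriv f (x 0) / f (x 0)) ^ 2) * z 0 * w 0
        + stereoLog c x ^ 2 * sdot x z * sdot x w - stereoLog c x * sdot z w) * v i.succ
      + (stereoLog c x * z i.succ - stereoLog c x ^ 2 * sdot x z * x i.succ) * sdot v w := by
  refine dchris_metric_eq_of_hasDerivAt hI hf hf0 hc hε hx z v w i.succ
    (fun y hy => chris_metric_succ hI hf hf0 hc hε hy v w i)
    (((((hasDerivAt_spaceLog_line hI hf hf0 hx z v).mul_const (w i.succ)).add
      ((hasDerivAt_spaceLog_line hI hf hf0 hx z w).mul_const (v i.succ))).add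
      (((hasDerivAt_stereoLog_line hx.2 z).mul (hasDerivAt_line x z i.succ)).mul_const
        (sdot v w))).congr_deriv ?_)
  simp only [zero_smul, add_zero]
  ring

theorem sdot_chris_metric (hI : IsOpen I) (hf : ContDiffOn ℝ ∞ f I) (hf0 : ∀ t ∈ I, f t ≠ 0)
    (hc : c = 1 ∨ c = 0 ∨ c = -1) (hε : ε = 1 ∨ ε = -1) (hx : x ∈ domain I c d)
    (y v w : Fin (d + 1) → ℝ) :
    sdot y (chris (metric f c ε) x v w)
      = spaceLog f c x v * sdot y w + spaceLog f c x w * sdot y v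
        + stereoLog c x * sdot y x * sdot v w := by
  have h : sdot y (chris (metric f c ε) x v w) = ∑ i : Fin d, y i.succ *
      (spaceLog f c x v * w i.succ + spaceLog f c x w * v i.succ
        + stereoLog c x * x i.succ * sdot v w) :=
    Finset.sum_congr rfl fun i _ => by rw [chris_metric_succ hI hf hf0 hc hε hx]
  rw [h]
  have e : ∀ i : Fin d, y i.succ *
      (spaceLog f c x v * w i.succ + spaceLog f c x w * v i.succ
        + stereoLog c x * x i.succ * sdot v w)
      = spaceLog f c x v * (y i.succ * w i.succ) + spaceLog f c x w * (y i.succ * v i.succ)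
        + stereoLog c x * sdot v w * (y i.succ * x i.succ) := fun i => by ring
  simp only [e, Finset.sum_add_distrib, ← Finset.mul_sum]
  have hs : ∀ p q : Fin (d + 1) → ℝ, ∑ i : Fin d, p i.succ * q i.succ = sdot p q :=
    fun _ _ => rfl
  simp only [hs]
  ring

/-- The curvature tensor of the Robertson-Walker space. The first summand is that of a space of
constant curvature `(f'² + c)/f²`. -/
theorem curvature_metric (hI : IsOpen I) (hf : ContDiffOn ℝ ∞ f I) (hf0 : ∀ t ∈ I, f t ≠ 0)
    (hc : c = 1 ∨ c = 0 ∨ c = -1) (hε : ε = 1 ∨ ε = -1) (hx : x ∈ domain I c d)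
    (v w z : Fin (d + 1) → ℝ) :
    curvature (metric f c ε) x v w z
      = ((deriv f (x 0) ^ 2 + c) / f (x 0) ^ 2) •
          (inner (metric f c ε) x w z • v - inner (metric f c ε) x v z • w)
        + (deriv (deriv f) (x 0) / f (x 0) - (deriv f (x 0) ^ 2 + c) / f (x 0) ^ 2) •
          (z 0 • (v 0 • w - w 0 • v)
            + (v 0 * inner (metric f c ε) x w z - w 0 * inner (metric f c ε) x v z)
              • (Pi.single 0 1 : Fin (d + 1) → ℝ)) := by
  have hfx := hf0 _ hx.1
  have hρ := hx.2
  -- In terms of `ρ = 1 + c|x|²/4` and `μ = c/(2ρ)`, this says that `c/ρ² = 2μ - μ²|x|²`.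
  have hK : (deriv f (x 0) ^ 2 + c) / f (x 0) ^ 2 * spaceFactor f c x
      = (deriv f (x 0) / f (x 0)) ^ 2 * spaceFactor f c x + 2 * stereoLog c x
        - stereoLog c x ^ 2 * sdot x x := by
    have hρx : stereoFactor c x = 1 + c * sdot x x / 4 := rfl
    unfold spaceFactor stereoLog
    field_simp
    rw [hρx]
    ring
  have hsp : ∀ y : Fin (d + 1) → ℝ, spaceLog f c x y
      = deriv f (x 0) / f (x 0) * y 0 - stereoLog c x * sdot x y := fun _ => rfl
  rw [curvature_eq]
  simp only [inner_metric hc hε hx.2]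
  set P := deriv f (x 0) / f (x 0)
  set K := (deriv f (x 0) ^ 2 + c) / f (x 0) ^ 2
  set Q := deriv (deriv f) (x 0) / f (x 0)
  set L := spaceFactor f c x
  set μ := stereoLog c x
  ext k
  cases k using Fin.cases with
  | zero =>
    simp only [Pi.add_apply, Pi.sub_apply, Pi.smul_apply, smul_eq_mul, Pi.single_eq_same,
      dchris_metric_zero hI hf hf0 hc hε hx, chris_metric_zero hI hf hf0 hc hε hx,
      sdot_chris_metric hI hf hf0 hc hε hx, hsp, sdot_comm _ x]
    rw [sdot_comm w v]
    ring
  | succ i =>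
    simp only [Pi.add_apply, Pi.sub_apply, Pi.smul_apply, smul_eq_mul,
      Pi.single_eq_of_ne (Fin.succ_ne_zero i),
      dchris_metric_succ hI hf hf0 hc hε hx, chris_metric_succ hI hf hf0 hc hε hx,
      chris_metric_zero hI hf hf0 hc hε hx,
      sdot_chris_metric hI hf hf0 hc hε hx, hsp, sdot_comm _ x]
    rw [sdot_comm w v]
    linear_combination (sdot v z * w i.succ - sdot w z * v i.succ) * hK

end Curvature
end RW

/-! ### Commuting `2 × 2` matrices -/

/-- The commutant of a non-scalar `2 × 2` matrix is commutative. -/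
theorem Matrix.commute_of_commute_of_ne_scalar {K : Type*} [Field K]
    {S M N : Matrix (Fin 2) (Fin 2) K} (hS : ∀ r : K, S ≠ r • (1 : Matrix (Fin 2) (Fin 2) K))
    (hM : Commute S M) (hN : Commute S N) : Commute M N := by
  -- The vectors `(A₀₁, A₁₀, A₁₁ - A₀₀)` and `(S₀₁, S₁₀, S₁₁ - S₀₀)` are proportional.
  have e : ∀ {A : Matrix (Fin 2) (Fin 2) K}, Commute S A →
      S 0 1 * A 1 0 = A 0 1 * S 1 0 ∧ S 0 1 * (A 1 1 - A 0 0) = A 0 1 * (S 1 1 - S 0 0) ∧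
      S 1 0 * (A 1 1 - A 0 0) = A 1 0 * (S 1 1 - S 0 0) := by
    intro A hA
    have h := fun i j => congrFun (congrFun hA.eq i) j
    simp only [Matrix.mul_apply, Fin.sum_univ_two] at h
    refine ⟨?_, ?_, ?_⟩
    · linear_combination h 0 0
    · linear_combination h 0 1
    · linear_combination -h 1 0
  obtain ⟨m1, m2, m3⟩ := e hM
  obtain ⟨n1, n2, n3⟩ := e hN
  have key : M 0 1 * N 1 0 = N 0 1 * M 1 0 ∧
      M 0 1 * (N 1 1 - N 0 0) = N 0 1 * (M 1 1 - M 0 0) ∧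
      M 1 0 * (N 1 1 - N 0 0) = N 1 0 * (M 1 1 - M 0 0) := by
    by_cases hb : S 0 1 = 0
    · by_cases hc : S 1 0 = 0
      · have hd : S 1 1 - S 0 0 ≠ 0 := by
          intro hd
          refine hS (S 0 0) ?_
          ext i j
          fin_cases i <;> fin_cases j <;> simp [hb, hc, sub_eq_zero.1 hd]
        have z : ∀ {p : K}, p * (S 1 1 - S 0 0) = 0 → p = 0 := fun h =>
          (mul_eq_zero.1 h).resolve_right hd
        rw [hb, zero_mul] at m2 n2
        rw [hc, zero_mul] at m3 n3
        rw [z m2.symm, z m3.symm, z n2.symm, z n3.symm]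
        simp
      · refine ⟨mul_left_cancel₀ hc ?_, mul_left_cancel₀ hc ?_, mul_left_cancel₀ hc ?_⟩
        · linear_combination -N 1 0 * m1 + M 1 0 * n1
        · rw [hb, zero_mul] at m1 n1
          rw [(mul_eq_zero.1 m1.symm).resolve_right hc,
            (mul_eq_zero.1 n1.symm).resolve_right hc]
          ring
        · linear_combination M 1 0 * n3 - N 1 0 * m3
    · refine ⟨mul_left_cancel₀ hb ?_, mul_left_cancel₀ hb ?_, mul_left_cancel₀ hb ?_⟩
      · linear_combination M 0 1 * n1 - N 0 1 * m1
      · linear_combination M 0 1 * n2 - N 0 1 * m2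
      · linear_combination (N 1 1 - N 0 0) * m1 + M 0 1 * n3 - N 1 0 * m2
  obtain ⟨k1, k2, k3⟩ := key
  refine Matrix.ext fun i j => ?_
  simp only [Matrix.mul_apply, Fin.sum_univ_two]
  fin_cases i <;> fin_cases j <;> simp only [Fin.zero_eta, Fin.mk_one]
  · linear_combination k1
  · linear_combination k2
  · linear_combination -k3
  · linear_combination -k1

/-! ### Parallel mean curvature vector and normal curvature -/

namespace Coord
section ParallelMeanCurvature
variable {m n : ℕ} {g : (Fin n → ℝ) → Matrix (Fin n) (Fin n) ℝ} {D : Set (Fin n → ℝ)}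
  {F : (Fin m → ℝ) → (Fin n → ℝ)} {U : Set (Fin m → ℝ)} {u : Fin m → ℝ}

namespace IsSubmanifoldOn
variable (S : IsSubmanifoldOn g D F U)
include S

theorem sum_inv_induced_mul (hu : u ∈ U) (l : Fin m) (r : Fin m → ℝ) :
    ∑ i, ∑ j, (induced g F u)⁻¹ i j * (induced g F u l j * r i) = r l := by
  have h1 : ∀ i, ∑ j, induced g F u l j * (induced g F u)⁻¹ j i = if l = i then 1 else 0 := by
    intro i
    rw [← Matrix.mul_apply, Matrix.mul_nonsing_inv _ (S.isUnit_det u hu), Matrix.one_apply]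
  calc _ = ∑ i, (∑ j, induced g F u l j * (induced g F u)⁻¹ j i) * r i := by
        simp only [Finset.sum_mul]
        refine Finset.sum_congr rfl fun i _ => Finset.sum_congr rfl fun j _ => ?_
        rw [(S.inv_induced_symm hu).apply j i]
        ring
    _ = r l := by simp [h1]

theorem sum_inv_induced_mul' (hu : u ∈ U) (l : Fin m) (r : Fin m → ℝ) :
    ∑ i, ∑ j, (induced g F u)⁻¹ i j * (induced g F u i l * r j) = r l := by
  rw [Finset.sum_comm, ← S.sum_inv_induced_mul hu l r]
  refine Finset.sum_congr rfl fun i _ => Finset.sum_congr rfl fun j _ => ?_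
  rw [(S.inv_induced_symm hu).apply i j, (S.isMetricOn_induced.symm u hu).apply l j]

theorem trace_inv_induced (hu : u ∈ U) :
    ∑ i, ∑ j, (induced g F u)⁻¹ i j * induced g F u i j = m := by
  have h : ((induced g F u)⁻¹ * induced g F u).trace = m := by
    rw [Matrix.nonsing_inv_mul _ (S.isUnit_det u hu), Matrix.trace_one, Fintype.card_fin]
  rw [← h, Matrix.trace]
  refine Finset.sum_congr rfl fun i _ => ?_
  rw [Matrix.diag_apply, Matrix.mul_apply]
  exact Finset.sum_congr rfl fun j _ => by rw [(S.isMetricOn_induced.symm u hu).apply j i]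

theorem normalConn_tension [NeZero m] (hu : u ∈ U)
    (hpar : ∀ i, normalConn g F i (meanCurvature g F) u = 0) (i : Fin m) :
    normalConn g F i (tension g F) u = 0 := by
  have hH : ∀ v ∈ U, meanCurvature g F v = (1 / (m : ℝ)) • tension g F v := fun v hv => by
    rw [S.tension_eq_smul hv, smul_smul, one_div_mul_cancel (NeZero.ne _), one_smul]
  have h1 := hpar i
  rw [normalConn, covDeriv_congr S.isOpen hu hH, covDeriv_smul (differentiableAt_const _)
    (differentiableAt_of_contDiffOn S.isOpen S.contDiffOn_tension hu)] at h1
  simp only [show pd i (fun _ : Fin m → ℝ => 1 / (m : ℝ)) u = 0 by simp [pd], zero_smul, zero_add,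
    (isLinearMap_normal g F u).map_smul] at h1
  exact (smul_eq_zero.1 h1).resolve_left (one_div_ne_zero (NeZero.ne _))

theorem trace_weingarten_tension (hu : u ∈ U) :
    (weingarten g F u (tension g F)).trace = -inner g (F u) (tension g F u) (tension g F u) := by
  have e : inner g (F u) (tension g F u) (tension g F u) = inner g (F u) (tension g F u)
      (∑ i, ∑ j, (induced g F u)⁻¹ i j • secondForm g F i j u) :=
    congrArg _ (S.tension_eq hu)
  rw [e, inner_sum_right, Matrix.trace, ← Finset.sum_neg_distrib]
  refine Finset.sum_congr rfl fun i _ => ?_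
  rw [inner_sum_right, ← Finset.sum_neg_distrib, Matrix.diag_apply, weingarten, Matrix.of_apply]
  refine Finset.sum_congr rfl fun j _ => ?_
  rw [S.inner_covDeriv_normal S.contDiffOn_tension (fun v hv => S.inner_tension_pd hv) hu,
    inner_smul_right]
  ring

/-- The Ricci equation, when the ambient curvature `R(X, Y)ξ` is tangential. -/
theorem normalCurvature_apply {X : (Fin m → ℝ) → (Fin n → ℝ)} (hX : ContDiffOn ℝ ∞ X U)
    (hu : u ∈ U) (i j : Fin m)
    (hR : normal g F u (curvature g (F u) (pd i F u) (pd j F u) (X u)) = 0) (p : Fin n) :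
    normalCurvature g F i j X u p
      = (weingarten g F u X * Matrix.of fun i j => secondForm g F i j u p) i j
        - (weingarten g F u X * Matrix.of fun i j => secondForm g F i j u p) j i := by
  rw [S.normalCurvature_eq hX hu, hR, zero_add, Finset.sum_apply, Matrix.mul_apply,
    Matrix.mul_apply, ← Finset.sum_sub_distrib]
  refine Finset.sum_congr rfl fun k _ => ?_
  simp [S.secondForm_symm hu k]

/-- For a normal field `X` and the coordinate `h^p` of the second fundamental form, the bilinear
form `h^p(A_X ·, ·)` is symmetric if and only if `A_X` commutes with the endomorphism defined
by `h^p`. -/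
theorem isSymm_weingarten_mul_iff {X : (Fin m → ℝ) → (Fin n → ℝ)} (hX : ContDiffOn ℝ ∞ X U)
    (hN : ∀ v ∈ U, ∀ l, inner g (F v) (X v) (pd l F v) = 0) (hu : u ∈ U) (p : Fin n) :
    (weingarten g F u X * Matrix.of fun i j => secondForm g F i j u p).IsSymm ↔
      Commute (weingarten g F u X)
        ((Matrix.of fun i j => secondForm g F i j u p) * (induced g F u)⁻¹) := by
  set h : Matrix (Fin m) (Fin m) ℝ := Matrix.of fun i j => secondForm g F i j u p with hh
  set A : Matrix (Fin m) (Fin m) ℝ :=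
    Matrix.of fun i j => -inner g (F u) (X u) (secondForm g F i j u) with hA
  have hsymm : h.transpose = h := by
    ext i j
    simp [hh, S.secondForm_symm hu j i]
  have hAsymm : A.transpose = A := by
    ext i j
    simp [hA, S.secondForm_symm hu j i]
  have hdet := S.isUnit_det u hu
  rw [S.weingarten_eq_mul hX hN hu, ← hA, Matrix.IsSymm, Matrix.transpose_mul,
    Matrix.transpose_mul, hsymm, hAsymm, (S.inv_induced_symm hu).eq, Commute, SemiconjBy]
  constructor
  · intro e
    rw [← Matrix.mul_assoc, ← e]
    simp only [Matrix.mul_assoc]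
  · intro e
    have e' := congrArg (· * induced g F u) e
    simp only [← Matrix.mul_assoc, Matrix.nonsing_inv_mul_cancel_right _ _ hdet] at e'
    rw [e', Matrix.mul_assoc]

end IsSubmanifoldOn

/-- If `∇^⊥ τ = 0` and the shape operator of `τ` is not scalar, then the normal bundle of a surface
is flat, provided that the ambient curvature `R(X, Y)ξ` is tangential. -/
theorem IsSubmanifoldOn.normalCurvature_eq_zero
    {F : (Fin 2 → ℝ) → (Fin n → ℝ)} {U : Set (Fin 2 → ℝ)} {u : Fin 2 → ℝ}
    (S : IsSubmanifoldOn g D F U) (hu : u ∈ U)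
    (hpar : ∀ v ∈ U, ∀ i, normalConn g F i (tension g F) v = 0)
    (hscalar : ∀ r : ℝ, weingarten g F u (tension g F) ≠ r • 1)
    (hR : ∀ ξ : Fin n → ℝ, (∀ l, inner g (F u) ξ (pd l F u) = 0) → ∀ i j,
      normal g F u (curvature g (F u) (pd i F u) (pd j F u) ξ) = 0)
    {X : (Fin 2 → ℝ) → (Fin n → ℝ)} (hX : ContDiffOn ℝ ∞ X U)
    (hN : ∀ v ∈ U, ∀ l, inner g (F v) (X v) (pd l F v) = 0) (i j : Fin 2) :
    normalCurvature g F i j X u = 0 := by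
  have nτ : ∀ v ∈ U, ∀ l, inner g (F v) (tension g F v) (pd l F v) = 0 := fun v hv =>
    S.inner_tension_pd hv
  have hflat : ∀ i j, normalCurvature g F i j (tension g F) u = 0 := by
    intro i j
    have h0 : ∀ i j, normalConn g F i (normalConn g F j (tension g F)) u = 0 := by
      intro i j
      rw [normalConn, covDeriv_congr S.isOpen hu (Y := fun _ => 0) fun v hv => hpar v hv j]
      have hz : covDeriv g F i (fun _ => 0) u = 0 := by
        ext k
        simp [covDeriv, pd]
      rw [hz, (isLinearMap_normal g F u).map_zero]
    rw [normalCurvature, h0, h0, sub_zero]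
  have hcomm : ∀ p, Commute (weingarten g F u (tension g F))
      ((Matrix.of fun i j => secondForm g F i j u p) * (induced g F u)⁻¹) := by
    intro p
    rw [← S.isSymm_weingarten_mul_iff S.contDiffOn_tension nτ hu]
    ext i j
    have h := S.normalCurvature_apply S.contDiffOn_tension hu i j (hR _ (nτ u hu) i j) p
    rw [hflat, Pi.zero_apply] at h
    rw [Matrix.transpose_apply]
    linarith
  have hcommX : Commute (weingarten g F u (tension g F)) (weingarten g F u X) := by
    rw [S.weingarten_eq_sum hX hN hu]
    exact (Commute.sum_right _ _ _ fun q _ => (hcomm q).smul_right _).neg_right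
  ext p
  rw [S.normalCurvature_apply hX hu i j (hR _ (hN u hu) i j) p, Pi.zero_apply]
  have h := (S.isSymm_weingarten_mul_iff hX hN hu p).2
    (Matrix.commute_of_commute_of_ne_scalar hscalar hcommX (hcomm p))
  rw [h.apply i j, sub_self]

end ParallelMeanCurvature
end Coord

/-! ### Biconservative surfaces in Robertson-Walker spaces -/

namespace RW
open Coord
section Surface
variable {d : ℕ} {I : Set ℝ} {f : ℝ → ℝ} {c ε : ℝ}
  {F : (Fin 2 → ℝ) → (Fin (d + 1) → ℝ)} {U : Set (Fin 2 → ℝ)} {u : Fin 2 → ℝ}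

theorem inner_metric_time (hc : c = 1 ∨ c = 0 ∨ c = -1) (hε : ε = 1 ∨ ε = -1)
    {x : Fin (d + 1) → ℝ} (hx : stereoFactor c x ≠ 0) (v : Fin (d + 1) → ℝ) :
    inner (metric f c ε) x (Pi.single 0 1) v = -v 0 := by
  simp [inner_metric hc hε hx, sdot]

theorem exists_pd_zero_ne_zero (hc : c = 1 ∨ c = 0 ∨ c = -1) (hε : ε = 1 ∨ ε = -1)
    (hx : stereoFactor c (F u) ≠ 0)
    (hT : tangential (metric f c ε) F u (Pi.single 0 1) ≠ 0) : ∃ l, pd l F u 0 ≠ 0 := by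
  by_contra! h
  exact hT (tangential_eq_zero fun l => by rw [inner_metric_time hc hε hx, h, neg_zero])

/-- For `∇^⊥ τ = 0`, biconservativity says that `⟨τ, ∂/∂t⟩ = 0`. -/
theorem tension_zero_eq_zero (hI : IsOpen I) (hf : ContDiffOn ℝ ∞ f I)
    (hf0 : ∀ t ∈ I, f t ≠ 0)
    (hcurv : ∀ t ∈ I, deriv (deriv f) t / f t - (deriv f t ^ 2 + c) / f t ^ 2 ≠ 0)
    (hc : c = 1 ∨ c = 0 ∨ c = -1) (hε : ε = 1 ∨ ε = -1)
    (S : IsSubmanifoldOn (metric f c ε) (domain I c d) F U) (hu : u ∈ U)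
    (hT : tangential (metric f c ε) F u (Pi.single 0 1) ≠ 0)
    (hpar : ∀ v ∈ U, ∀ i, normalConn (metric f c ε) F i (tension (metric f c ε) F) v = 0)
    (hbic : tangential (metric f c ε) F u (bitension (metric f c ε) F u) = 0) :
    tension (metric f c ε) F u 0 = 0 := by
  have hx := S.mapsTo hu
  obtain ⟨l, hl⟩ := exists_pd_zero_ne_zero hc hε hx.2 hT
  have hR := fun v w z => curvature_metric hI hf hf0 hc hε hx v w z
  have ht := fun v => inner_metric_time (f := f) hc hε hx.2 v
  have hK' := hcurv _ hx.1
  set g := metric f c ε (d := d)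
  set τ := tension g F
  set K := (deriv f (F u 0) ^ 2 + c) / f (F u 0) ^ 2
  set K' := deriv (deriv f) (F u 0) / f (F u 0) - K
  have nτ : ∀ l, inner g (F u) (τ u) (pd l F u) = 0 := S.inner_tension_pd hu
  have nτ' : ∀ l, inner g (F u) (pd l F u) (τ u) = 0 := fun l => by
    rw [S.inner_comm' hu, nτ]
  have hind : ∀ i j, inner g (F u) (pd i F u) (pd j F u) = induced g F u i j := fun _ _ => rfl
  have h1 : ∀ i j, inner g (F u) (curvature g (F u) (pd i F u) (pd l F u) (τ u)) (pd j F u)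
      = K' * τ u 0 * (induced g F u l j * pd i F u 0 - induced g F u i j * pd l F u 0) := by
    intro i j
    rw [hR]
    simp only [Coord.inner_add_left, Coord.inner_sub_left, Coord.inner_smul_left, nτ', hind, ht]
    ring
  have h2 : ∀ i j, inner g (F u) (curvature g (F u) (pd i F u) (τ u) (pd j F u)) (pd l F u)
      = K' * τ u 0 * (induced g F u i j * pd l F u 0 - induced g F u i l * pd j F u 0) := by
    intro i j
    rw [hR]
    simp only [Coord.inner_add_left, Coord.inner_sub_left, Coord.inner_smul_left, nτ, hind, ht]
    ring
  have h3 : inner g (F u) (bitension g F u) (pd l F u) = 0 := by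
    rw [← S.inner_tangential hu, hbic, Coord.inner_zero_left]
  rw [bitension, Coord.inner_sub_left, S.inner_roughLaplacian_tension hpar hu,
    Coord.inner_sum_left] at h3
  simp only [Coord.inner_sum_left, Coord.inner_smul_left] at h3
  rw [← Finset.sum_sub_distrib] at h3
  simp only [← Finset.sum_sub_distrib] at h3
  have h4 : ∀ i j, (induced g F u)⁻¹ i j
        * inner g (F u) (curvature g (F u) (pd i F u) (pd l F u) (τ u)) (pd j F u)
      - (induced g F u)⁻¹ i j
        * inner g (F u) (curvature g (F u) (pd i F u) (τ u) (pd j F u)) (pd l F u)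
      = K' * τ u 0 * ((induced g F u)⁻¹ i j * (induced g F u l j * pd i F u 0)
        + (induced g F u)⁻¹ i j * (induced g F u i l * pd j F u 0)
        - 2 * pd l F u 0 * ((induced g F u)⁻¹ i j * induced g F u i j)) := by
    intro i j
    rw [h1, h2]
    ring
  change ∑ i, ∑ j, ((induced g F u)⁻¹ i j
        * inner g (F u) (curvature g (F u) (pd i F u) (pd l F u) (τ u)) (pd j F u)
      - (induced g F u)⁻¹ i j
        * inner g (F u) (curvature g (F u) (pd i F u) (τ u) (pd j F u)) (pd l F u)) = 0 at h3
  simp only [h4, ← Finset.mul_sum, Finset.sum_add_distrib, Finset.sum_sub_distrib] at h3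
  rw [S.sum_inv_induced_mul hu l (fun i => pd i F u 0),
    S.sum_inv_induced_mul' hu l (fun i => pd i F u 0), S.trace_inv_induced hu] at h3
  have h5 : K' * τ u 0 * (-2 * pd l F u 0) = 0 := by
    rw [← h3]; push_cast; ring
  simpa [hK', hl] using h5

/-- `A_τ T = 0`: the `i`-th coordinate of the left side is the `t`-component of the tangential part
of `∇_{∂_i} τ`, that is, `⟨A_τ ∂_i, T⟩`. It vanishes as `⟨τ, ∂/∂t⟩ = 0` and `∇_X ∂/∂t` is a
combination of `X` and `∂/∂t`. -/
theorem weingarten_tension_mulVec (hI : IsOpen I) (hf : ContDiffOn ℝ ∞ f I)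
    (hf0 : ∀ t ∈ I, f t ≠ 0) (hc : c = 1 ∨ c = 0 ∨ c = -1) (hε : ε = 1 ∨ ε = -1)
    (S : IsSubmanifoldOn (metric f c ε) (domain I c d) F U) (hu : u ∈ U)
    (hpar : ∀ v ∈ U, ∀ i, normalConn (metric f c ε) F i (tension (metric f c ε) F) v = 0)
    (h0 : ∀ v ∈ U, tension (metric f c ε) F v 0 = 0) :
    (weingarten (metric f c ε) F u (tension (metric f c ε) F)).mulVec (fun k => pd k F u 0)
      = 0 := by
  have hx := S.mapsTo hu
  ext i
  have hp : pd i (tension (metric f c ε) F) u 0 = 0 := by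
    rw [← pd_apply (differentiableAt_of_contDiffOn S.isOpen S.contDiffOn_tension hu),
      pd_congr S.isOpen hu h0]
    simp [pd]
  have hs : spaceFactor f c (F u) * sdot (pd i F u) (tension (metric f c ε) F u) = 0 := by
    have h := S.inner_tension_pd hu i
    rw [inner_metric hc hε hx.2, h0 u hu, sdot_comm] at h
    simpa using h
  have h1 : covDeriv (metric f c ε) F i (tension (metric f c ε) F) u 0 = 0 := by
    rw [covDeriv_eq, Pi.add_apply, hp, chris_metric_zero hI hf hf0 hc hε hx, mul_assoc, hs]
    simp
  have h2 := hpar u hu i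
  rw [normalConn, normal, tangential_covDeriv, sub_eq_zero] at h2
  rw [h2, Finset.sum_apply] at h1
  exact h1

/-- `A_τ` has the nonzero vector `T` in its kernel, and its trace `⟨τ, τ⟩` is positive because
`τ` has no time component. -/
theorem weingarten_tension_ne_scalar (hI : IsOpen I) (hf : ContDiffOn ℝ ∞ f I)
    (hf0 : ∀ t ∈ I, f t ≠ 0) (hc : c = 1 ∨ c = 0 ∨ c = -1) (hε : ε = 1 ∨ ε = -1)
    (S : IsSubmanifoldOn (metric f c ε) (domain I c d) F U) (hu : u ∈ U)
    (hT : tangential (metric f c ε) F u (Pi.single 0 1) ≠ 0)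
    (hτ : tension (metric f c ε) F u ≠ 0)
    (hpar : ∀ v ∈ U, ∀ i, normalConn (metric f c ε) F i (tension (metric f c ε) F) v = 0)
    (h0 : ∀ v ∈ U, tension (metric f c ε) F v 0 = 0) (r : ℝ) :
    weingarten (metric f c ε) F u (tension (metric f c ε) F) ≠ r • 1 := by
  intro hr
  have hx := S.mapsTo hu
  obtain ⟨l, hl⟩ := exists_pd_zero_ne_zero hc hε hx.2 hT
  have h1 := congrFun (weingarten_tension_mulVec hI hf hf0 hc hε S hu hpar h0) l
  have h2 := S.trace_weingarten_tension hu
  rw [hr] at h1 h2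
  have hr0 : r = 0 := by simpa [Matrix.smul_mulVec, hl] using h1
  rw [hr0, zero_smul, Matrix.trace_zero, inner_metric hc hε hx.2, h0 u hu] at h2
  have := mul_pos (spaceFactor_pos hx.2 (hf0 _ hx.1)) (sdot_self_pos (h0 u hu) hτ)
  linarith

/-- For normal `ξ` only the term `ξ⁰(v⁰w - w⁰v)` of `R(v, w)ξ` survives, which is tangential. -/
theorem normal_curvature_metric (hI : IsOpen I) (hf : ContDiffOn ℝ ∞ f I)
    (hf0 : ∀ t ∈ I, f t ≠ 0) (hc : c = 1 ∨ c = 0 ∨ c = -1) (hε : ε = 1 ∨ ε = -1)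
    (S : IsSubmanifoldOn (metric f c ε) (domain I c d) F U) (hu : u ∈ U)
    {ξ : Fin (d + 1) → ℝ} (hξ : ∀ l, inner (metric f c ε) (F u) ξ (pd l F u) = 0) (i j : Fin 2) :
    normal (metric f c ε) F u
      (curvature (metric f c ε) (F u) (pd i F u) (pd j F u) ξ) = 0 := by
  have hξ' : ∀ l, inner (metric f c ε) (F u) (pd l F u) ξ = 0 := fun l => by
    rw [S.inner_comm' hu, hξ]
  rw [curvature_metric hI hf hf0 hc hε (S.mapsTo hu)]
  have L := isLinearMap_normal (metric f c ε) F u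
  simp [hξ', L.map_sub, L.map_smul, S.normal_pd hu]

/-! ### Coordinate expressions of a map from a surface -/

section LocalRep
variable {M : Type*} [TopologicalSpace M] {φ : M → ℝ × ℝ × (Fin d → ℝ)}
  {e : OpenPartialHomeomorph M (Fin 2 → ℝ)}

theorem isOpen_localDom (hφ : Continuous φ) : IsOpen (localDom φ e ε) := by
  have h : ContinuousOn (fun u => 1 + ε * (φ (e.symm u)).2.1) e.target :=
    (by fun_prop : Continuous fun w : ℝ × ℝ × (Fin d → ℝ) => 1 + ε * w.2.1).comp_continuousOn
      (hφ.comp_continuousOn e.continuousOn_symm)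
  exact h.isOpen_inter_preimage e.open_target isOpen_Ioi

theorem contDiffOn_localRep [ChartedSpace (Fin 2 → ℝ) M] [IsManifold 𝓘(ℝ, Fin 2 → ℝ) ∞ M]
    (hφ : ContMDiff 𝓘(ℝ, Fin 2 → ℝ) 𝓘(ℝ, ℝ × ℝ × (Fin d → ℝ)) ∞ φ)
    (he : e ∈ atlas (Fin 2 → ℝ) M) : ContDiffOn ℝ ∞ (localRep φ e ε) (localDom φ e ε) := by
  have h1 : ContDiffOn ℝ ∞ (fun u => φ (e.symm u)) (localDom φ e ε) :=
    (contMDiffOn_iff_contDiffOn.1 (hφ.comp_contMDiffOn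
      (contMDiffOn_symm_of_mem_maximalAtlas (IsManifold.subset_maximalAtlas he)))).mono
      fun u hu => hu.1
  refine contDiffOn_pi.2 fun a => ?_
  cases a using Fin.cases with
  | zero => exact h1.fst
  | succ i =>
    have h2 : ContDiffOn ℝ ∞ (fun u => (φ (e.symm u)).2.1) (localDom φ e ε) := h1.snd.fst
    have h3 : ContDiffOn ℝ ∞ (fun u => (φ (e.symm u)).2.2 i) (localDom φ e ε) :=
      contDiffOn_pi.1 h1.snd.snd i
    exact (contDiffOn_const.mul h3).div (contDiffOn_const.add (contDiffOn_const.mul h2))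
      fun u hu => hu.2.ne'

theorem stereoFactor_coord (hε : ε = 1 ∨ ε = -1) {w : ℝ × ℝ × (Fin d → ℝ)}
    (hw : w ∈ space I c d) (h : 0 < 1 + ε * w.2.1) :
    stereoFactor c (coord ε w) = 2 / (1 + ε * w.2.1) := by
  have h1 := hw.2.1
  have hεε : ε ^ 2 = 1 := by rcases hε with rfl | rfl <;> norm_num
  have h2 : sdot (coord ε w) (coord ε w)
      = 4 * (∑ i, w.2.2 i ^ 2) / (1 + ε * w.2.1) ^ 2 := by
    simp only [sdot, coord, Fin.cons_succ, Finset.mul_sum, Finset.sum_div]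
    exact Finset.sum_congr rfl fun i _ => by field_simp; ring
  rw [stereoFactor, h2]
  field_simp
  linear_combination h1 + w.2.1 ^ 2 * hεε

theorem mapsTo_localRep (hε : ε = 1 ∨ ε = -1) (hφL : ∀ p, φ p ∈ space I c d) :
    Set.MapsTo (localRep φ e ε) (localDom φ e ε) (domain I c d) := fun u hu =>
  ⟨(hφL (e.symm u)).1, by
    rw [localRep, stereoFactor_coord hε (hφL _) hu.2]
    exact div_ne_zero two_ne_zero hu.2.ne'⟩

end LocalRep
end Surface
end RW

end

theorem mainTheorem9 (d : ℕ) (hd : 3 ≤ d) (c : ℝ) (hc : c = 1 ∨ c = 0 ∨ c = -1)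
    (I : Set ℝ) (hIopen : IsOpen I) (hIconn : I.OrdConnected)
    (f : ℝ → ℝ) (hf : ContDiffOn ℝ ∞ f I) (hf0 : ∀ t ∈ I, f t ≠ 0)
    (hcurv : ∀ t ∈ I, deriv (deriv f) t / f t - (deriv f t ^ 2 + c) / f t ^ 2 ≠ 0)
    (M : Type*) [TopologicalSpace M] [ConnectedSpace M] [ChartedSpace (Fin 2 → ℝ) M]
    [IsManifold 𝓘(ℝ, Fin 2 → ℝ) ∞ M]
    (φ : M → ℝ × ℝ × (Fin d → ℝ))
    (hφ : ContMDiff 𝓘(ℝ, Fin 2 → ℝ) 𝓘(ℝ, ℝ × ℝ × (Fin d → ℝ)) ∞ φ)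
    (hφL : ∀ p, φ p ∈ RW.space I c d)
    (hspace : RW.IsSpacelike f c φ)
    (hT : RW.TangentialPartNeZero f c φ)
    (hH : RW.MeanCurvatureNeZero f c φ)
    (hpmcv : RW.IsPMCV f c φ)
    (hbic : RW.IsBiconservative f c φ) :
    RW.HasFlatNormalBundle f c φ := by
  intro e he ε hε u hu V ξ hV huV hξ i j
  have S : Coord.IsSubmanifoldOn (RW.metric f c ε) (RW.domain I c d) (RW.localRep φ e ε)
      (RW.localDom φ e ε) :=
    { isMetricOn := RW.isMetricOn_metric hIopen hf hf0 hc hε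
      isOpen := RW.isOpen_localDom hφ.continuous
      contDiffOn := RW.contDiffOn_localRep hφ he
      mapsTo := RW.mapsTo_localRep hε hφL
      isUnit_det := fun v hv => (hspace e he ε hε v hv).det_pos.ne'.isUnit }
  have hpar : ∀ v ∈ RW.localDom φ e ε, ∀ i, Coord.normalConn (RW.metric f c ε)
      (RW.localRep φ e ε) i (Coord.tension (RW.metric f c ε) (RW.localRep φ e ε)) v = 0 :=
    fun v hv => S.normalConn_tension hv (hpmcv e he ε hε v hv)
  have h0 : ∀ v ∈ RW.localDom φ e ε,
      Coord.tension (RW.metric f c ε) (RW.localRep φ e ε) v 0 = 0 := fun v hv =>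
    RW.tension_zero_eq_zero hIopen hf hf0 hcurv hc hε S hv (hT e he ε hε v hv) hpar
      (hbic e he ε hε v hv)
  have hτ : Coord.tension (RW.metric f c ε) (RW.localRep φ e ε) u ≠ 0 := by
    rw [S.tension_eq_smul hu]
    exact smul_ne_zero (by norm_num) (hH e he ε hε u hu)
  have hscalar := RW.weingarten_tension_ne_scalar hIopen hf hf0 hc hε S hu (hT e he ε hε u hu)
    hτ hpar h0
  -- the normal field is only given on `V`
  have S' := S.mono (S.isOpen.inter hV) Set.inter_subset_left
  exact S'.normalCurvature_eq_zero ⟨hu, huV⟩ (fun v hv => hpar v hv.1) hscalar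
    (fun ζ hζ => RW.normal_curvature_metric hIopen hf hf0 hc hε S hu hζ)
    (hξ.1.mono Set.inter_subset_right) (fun v hv => hξ.2 v hv.2) i j
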